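/- Let $(V,\|\cdot\|)$ be an infinite-dimensional real Hilbert space and let $a,b$ be symmetric bilinear forms on $V$ with $a(w,v)\le K\|w\|\|v\|$, $\|w\|^2\le K\,a(w,w)$ for some $K>0$ and all $w,v\in V$, and $b(w,w)>0$ for $w\ne0$; put $\|w\|_a=a(w,w)^{1/2}$, $\|w\|_b=b(w,w)^{1/2}$, and assume that every $\|\cdot\|$-bounded sequence has a $\|\cdot\|_b$-Cauchy subsequence. Let $0<\lambda_1\le\lambda_2\le\cdots$ be the eigenvalues, repeated according to multiplicity, of $a(u,v)=\lambda b(u,v)$ for all $v\in V$, and let $M(\lambda_1)$ be the eigenspace of $\lambda_1$. For a finite-dimensional subspace $V_h\subset V$ let $\bar\lambda_{1,h}\le\bar\lambda_{2,h}\le\cdots$ be the eigenvalues, repeated according to multiplicity, of the same problem posed on $V_h$, and let $$\delta_h(\lambda_1)=\sup_{w\in M(\lambda_1),\,\|w\|_a=1}\ \inf_{v\in V_h}\|w-v\|_a .$$ Let $T:V\to V$ be given by $a(Tf,v)=b(f,v)$ for all $v\in V$, let $P_h:V\to V_h$ be the $a$-orthogonal projection, and let $$\Pi_{1,h}=\frac1{2\pi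 i}\oint_\Gamma (z-P_hT)^{-1}\,dz,$$ where $\Gamma\subset\mathbb C$ is a fixed circle that encloses the eigenvalue $1/\lambda_1$ of $T$ and has all other eigenvalues of $T$ strictly outside. Let $(V_h)$ be a family of finite-dimensional subspaces of $V$ with mesh sizes $h>0$ such that $\inf_{v\in V_h}\|w-v\|_a\to0$ as $h\to0$ for every $w\in V$. Let $\beta>1$ and $c_0,C_0>0$. Then there is a constant $C>0$ such that for all $C_4,C_5>0$ there is $h_0>0$ with the following property. Let $n\ge1$ and let $V_{h_1}\subset V_{h_2}\subset\cdots\subset V_{h_n}$ be members of the family with $h_{k+1}=h_k/\beta$, $h_1<h_0$ and $c_0h_k\le\delta_{h_k}(\lambda_1)\le C_0h_k$ for $k=1,\dots,n$. Let $(\lambda_{1,h_k},u_{1,h_k})$, $k=1,\dots,n$, be produced by the multigrid scheme: 1. $\lambda_{1,h_1}=\bar\lambda_{1,h_1}$, and $u_{1,h_1}\in V_{h_1}$ is a corresponding eigenfunction of the problem on $V_{h_1}$ with $\|u_{1,h_1}\|_a=1$. 2. For $k=1,\dots,n-1$, $\widehat u_{1,h_{k+1}}\in V_{h_{k+1}}$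 satisfies $$a(\widehat u_{1,h_{k+1}},v)-\alpha_{1,k+1}\,b(\widehat u_{1,h_{k+1}},v)=b(u_{1,h_k},v)\qquad\forall v\in V_{h_{k+1}},$$ and $$u_{1,h_{k+1}}=\frac{\widehat u_{1,h_{k+1}}}{\|\widehat u_{1,h_{k+1}}\|_a},\qquad \lambda_{1,h_{k+1}}=\frac{a(u_{1,h_{k+1}},u_{1,h_{k+1}})}{b(u_{1,h_{k+1}},u_{1,h_{k+1}})},$$ where, with $\lambda_{2,h_1}=\bar\lambda_{2,h_1}$, $$\alpha_{1,k+1}=\max\Big\{0,\ \frac{2(1+C_4/C_5)\beta\lambda_{1,h_k}-\lambda_{2,h_1}}{2(1+C_4/C_5)\beta-1}\Big\}.$$ Then $$\|u_{1,h_n}-\Pi_{1,h_n}u_{1,h_n}\|_a\le C\,\delta_{h_n}(\lambda_1),\qquad |\lambda_{1,h_n}-\bar\lambda_{1,h_n}|\le C\,\delta_{h_n}^2(\lambda_1),$$ and there is $u_1\in M(\lambda_1)$ with $\|u_1\|_a=1$ such that $$\|u_1-u_{1,h_n}\|_a\le C\,\delta_{h_n}(\lambda_1),\qquad |\lambda_1-\lambda_{1,h_n}|\le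 C\,\delta_{h_n}^2(\lambda_1).$$ In particular, the first two estimates hold with $C_5$ in place of $C$ whenever $C_5\ge C$. -/

import Mathlib

open Filter Topology TensorProduct

noncomputable section

namespace EigMG

section Forms

variable {V : Type*} [AddCommGroup V] [Module ℝ V]

/-- The (energy) norm `√(a(w,w))` of a bilinear form `a`. -/
def formNorm (a : V →ₗ[ℝ] V →ₗ[ℝ] ℝ) (w : V) : ℝ := Real.sqrt (a w w)

/-- Best approximation error `inf_{v ∈ W} ‖w - v‖_a`. -/
def bestApprox (a : V →ₗ[ℝ] V →ₗ[ℝ] ℝ) (W : Submodule ℝ V) (w : V) : ℝ :=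
  ⨅ v : W, formNorm a (w - (v : V))

/-- The space of all `w ∈ W` with `a(w,v) = t b(w,v)` for all `v ∈ W`: the eigenspace of the
eigenvalue problem posed on `W` (`W = ⊤` is the continuous problem, `W = V_h` the discrete one). -/
def eigSpace (a b : V →ₗ[ℝ] V →ₗ[ℝ] ℝ) (W : Submodule ℝ V) (t : ℝ) : Submodule ℝ V where
  carrier := {w | w ∈ W ∧ ∀ v ∈ W, a w v = t * b w v}
  zero_mem' := ⟨W.zero_mem, by simp⟩
  add_mem' := by
    rintro x y ⟨hx, hx'⟩ ⟨hy, hy'⟩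
    refine ⟨W.add_mem hx hy, fun v hv => ?_⟩
    simp only [map_add, LinearMap.add_apply, hx' v hv, hy' v hv]
    ring
  smul_mem' := by
    rintro c x ⟨hx, hx'⟩
    refine ⟨W.smul_mem c hx, fun v hv => ?_⟩
    simp only [map_smul, LinearMap.smul_apply, hx' v hv, smul_eq_mul]
    ring

/-- The `j`-th eigenvalue (`j = 1, 2, …`) of the problem posed on `W`, in increasing order and
repeated according to multiplicity: the least `t` such that the eigenspaces belonging to the
eigenvalues `≤ t` span a space of dimension at least `j`. -/
def eigVal (a b : V →ₗ[ℝ] V →ₗ[ℝ] ℝ) (W : Submodule ℝ V) (j : ℕ) : ℝ :=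
  sInf {t : ℝ | (j : Cardinal) ≤
    Module.rank ℝ (⨆ s : Set.Iic t, eigSpace a b W (s : ℝ) : Submodule ℝ V)}

/-- `δ_W(λ_1) = sup { inf_{v ∈ W} ‖w - v‖_a : w ∈ M(λ_1), ‖w‖_a = 1 }`, where `M(λ_1)` is the
eigenspace of the first eigenvalue of the continuous problem. -/
def deltaOne (a b : V →ₗ[ℝ] V →ₗ[ℝ] ℝ) (W : Submodule ℝ V) : ℝ :=
  ⨆ w : {w : V // w ∈ eigSpace a b ⊤ (eigVal a b ⊤ 1) ∧ formNorm a w = 1}, bestApprox a W w.1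

open Classical in
/-- The solution operator `T`, given by `a(T f, v) = b(f, v)` for all `v`
(see `EigenForms.solOp_spec`). -/
def solOp (a b : V →ₗ[ℝ] V →ₗ[ℝ] ℝ) : V →ₗ[ℝ] V :=
  if h : ∃ T : V →ₗ[ℝ] V, ∀ f v, a (T f) v = b f v then h.choose else 0

open Classical in
/-- The Galerkin projection `P` onto `W`, given by `P w ∈ W` and `a(w - P w, v) = 0` for all
`v ∈ W` (see `EigenForms.galerkin_spec`). -/
def galerkin (a : V →ₗ[ℝ] V →ₗ[ℝ] ℝ) (W : Submodule ℝ V) : V →ₗ[ℝ] V :=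
  if h : ∃ P : V →ₗ[ℝ] V, (∀ w, P w ∈ W) ∧ ∀ w, ∀ v ∈ W, a (w - P w) v = 0 then h.choose else 0

/-- `Q = (2πi)⁻¹ ∮ (z - A)⁻¹ dz` over the circle with centre `c` and radius `ρ`. The resolvent is
taken in the complexification `ℂ ⊗ V`, and the operator-valued integral is understood weakly,
tested against the functionals `a(·, v)` extended complex linearly. -/
def IsContourProj (a : V →ₗ[ℝ] V →ₗ[ℝ] ℝ) (A : V →ₗ[ℝ] V) (c : ℂ) (ρ : ℝ)
    (Q : V →ₗ[ℝ] V) : Prop :=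
  ∀ u v : V, ((a (Q u) v : ℝ) : ℂ) =
    (2 * (Real.pi : ℂ) * Complex.I)⁻¹ * ∮ z in C(c, ρ),
      LinearMap.liftBaseChange ℂ (Complex.ofRealCLM.toLinearMap ∘ₗ a.flip v)
        ((resolvent (A.baseChange ℂ : Module.End ℂ (ℂ ⊗[ℝ] V)) z) ((1 : ℂ) ⊗ₜ[ℝ] u))

open Classical in
/-- The spectral projection `(2πi)⁻¹ ∮ (z - P T)⁻¹ dz` over the circle with centre `c` and radius
`ρ`, with `P` the Galerkin projection onto `W`. The value `0` if the contour integral is not a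
real operator does not occur when the circle avoids the spectrum of `P T`. -/
def spectralProj (a b : V →ₗ[ℝ] V →ₗ[ℝ] ℝ) (W : Submodule ℝ V) (c : ℂ) (ρ : ℝ) : V →ₗ[ℝ] V :=
  if h : ∃ Q : V →ₗ[ℝ] V, IsContourProj a (galerkin a W ∘ₗ solOp a b) c ρ Q
    then h.choose else 0

/-- The circle with centre `c` and radius `ρ` encloses the eigenvalue `1/λ_1` of `T`, and all other
eigenvalues `1/s` of `T` lie strictly outside. -/
def EnclosesFirst (a b : V →ₗ[ℝ] V →ₗ[ℝ] ℝ) (c : ℂ) (ρ : ℝ) : Prop :=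
  (((eigVal a b ⊤ 1)⁻¹ : ℝ) : ℂ) ∈ Metric.ball c ρ ∧
  ∀ s : ℝ, eigSpace a b ⊤ s ≠ ⊥ → s ≠ eigVal a b ⊤ 1 →
    ((s⁻¹ : ℝ) : ℂ) ∉ Metric.closedBall c ρ

/-- One shifted-inverse power iteration step with shift `α` on the space `W`, started from `u` and
returning `(lam', u')`: solve for `û ∈ W`, normalize, and take the Rayleigh quotient. -/
def IsCorrection (a b : V →ₗ[ℝ] V →ₗ[ℝ] ℝ) (α : ℝ) (u : V) (W : Submodule ℝ V)
    (lam' : ℝ) (u' : V) : Prop :=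
  ∃ uhat ∈ W, (∀ v ∈ W, a uhat v - α * b uhat v = b u v) ∧
    u' = (formNorm a uhat)⁻¹ • uhat ∧ lam' = a u' u' / b u' u'

/-- The shift `max {0, (2(1+C₄/C₅)β lam - lam2) / (2(1+C₄/C₅)β - 1)}`. -/
def shift (C₄ C₅ β lam lam2 : ℝ) : ℝ :=
  max 0 ((2 * (1 + C₄ / C₅) * β * lam - lam2) / (2 * (1 + C₄ / C₅) * β - 1))

/-- `(lam k, u k)`, `k = 1, …, n`, is produced by the eigenvalue multigrid scheme on the spaces
`W 1, …, W n`: a first eigenpair on `W 1`, then one correction step on each finer level, with the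
shift computed from `lam k` and the second eigenvalue on `W 1`. -/
structure IsMultigridRun (a b : V →ₗ[ℝ] V →ₗ[ℝ] ℝ) (C₄ C₅ β : ℝ) (n : ℕ)
    (W : ℕ → Submodule ℝ V) (lam : ℕ → ℝ) (u : ℕ → V) : Prop where
  init_val : lam 1 = eigVal a b (W 1) 1
  init_vec : u 1 ∈ eigSpace a b (W 1) (lam 1)
  init_norm : a (u 1) (u 1) = 1
  step : ∀ k, 1 ≤ k → k < n →
    IsCorrection a b (shift C₄ C₅ β (lam k) (eigVal a b (W 1) 2)) (u k) (W (k + 1))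
      (lam (k + 1)) (u (k + 1))

end Forms

/-- The two forms of the eigenvalue problem on a real Hilbert space `V`: `a` is symmetric, bounded
and coercive, `b` is symmetric and positive definite, and every bounded sequence in `V` has a
subsequence which is Cauchy with respect to `‖·‖_b`. -/
structure EigenForms {V : Type*} [NormedAddCommGroup V] [InnerProductSpace ℝ V]
    (a b : V →ₗ[ℝ] V →ₗ[ℝ] ℝ) : Prop where
  a_symm : ∀ w v, a w v = a v w
  b_symm : ∀ w v, b w v = b v w
  a_bounded : ∃ C : ℝ, ∀ w v, a w v ≤ C * ‖w‖ * ‖v‖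
  a_coercive : ∃ c : ℝ, 0 < c ∧ ∀ w, c * ‖w‖ ^ 2 ≤ a w w
  b_pos : ∀ w, w ≠ 0 → 0 < b w w
  b_compact : ∀ w : ℕ → V, (∃ R : ℝ, ∀ n, ‖w n‖ ≤ R) → ∃ φ : ℕ → ℕ, StrictMono φ ∧
    ∀ ε : ℝ, 0 < ε → ∃ N, ∀ m n, N ≤ m → N ≤ n → formNorm b (w (φ m) - w (φ n)) < ε

/-- A family of finite-dimensional subspaces `V_i`, with mesh sizes `h_i > 0`, such that
`inf_{v ∈ V_i} ‖w - v‖_a → 0` as `h_i → 0`, for every `w`. -/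
structure IsApproxFamily {V : Type*} [AddCommGroup V] [Module ℝ V] (a : V →ₗ[ℝ] V →ₗ[ℝ] ℝ)
    {ι : Type*} (size : ι → ℝ) (Vh : ι → Submodule ℝ V) : Prop where
  size_pos : ∀ i, 0 < size i
  finite_dim : ∀ i, FiniteDimensional ℝ (Vh i)
  approx : ∀ w, Tendsto (fun i => bestApprox a (Vh i) w) (comap size (𝓝[>] 0)) (𝓝 0)

/-- The spaces `Vh (τ 1) ⊆ … ⊆ Vh (τ n)` form a multilevel hierarchy with refinement factor `β`:
they are nested, `h_{k+1} = h_k / β`, and `c₀ h_k ≤ δ_{h_k}(λ_1) ≤ C₀ h_k`. -/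
structure IsHierarchy {V : Type*} [AddCommGroup V] [Module ℝ V] (a b : V →ₗ[ℝ] V →ₗ[ℝ] ℝ)
    {ι : Type*} (size : ι → ℝ) (Vh : ι → Submodule ℝ V) (β c₀ C₀ : ℝ) (n : ℕ) (τ : ℕ → ι) :
    Prop where
  nested : ∀ k, 1 ≤ k → k < n → Vh (τ k) ≤ Vh (τ (k + 1))
  refine_size : ∀ k, 1 ≤ k → k < n → size (τ (k + 1)) = size (τ k) / β
  delta_order : ∀ k, 1 ≤ k → k ≤ n → c₀ * size (τ k) ≤ deltaOne a b (Vh (τ k)) ∧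
    deltaOne a b (Vh (τ k)) ≤ C₀ * size (τ k)

namespace EigenForms

variable {V : Type*} [NormedAddCommGroup V] [InnerProductSpace ℝ V] {a b : V →ₗ[ℝ] V →ₗ[ℝ] ℝ}

theorem b_nonneg (h : EigenForms a b) (w : V) : 0 ≤ b w w := by
  by_cases hw : w = 0
  · simp [hw]
  · exact (h.b_pos w hw).le

theorem b_cauchy (h : EigenForms a b) (w v : V) : (b w v) ^ 2 ≤ b w w * b v v :=
  LinearMap.BilinForm.apply_sq_le_of_symm b h.b_nonneg ⟨fun x y => h.b_symm x y⟩ w v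

theorem a_abs_le (h : EigenForms a b) : ∃ C : ℝ, ∀ w v, ‖a w v‖ ≤ C * ‖w‖ * ‖v‖ := by
  obtain ⟨C, hC⟩ := h.a_bounded
  refine ⟨C, fun w v => ?_⟩
  rw [Real.norm_eq_abs, abs_le]
  have h1 := hC (-w) v
  rw [map_neg, LinearMap.neg_apply, norm_neg] at h1
  exact ⟨by linarith, hC w v⟩

theorem a_pos (h : EigenForms a b) (w : V) (hw : w ≠ 0) : 0 < a w w := by
  obtain ⟨c, hc, hcw⟩ := h.a_coercive
  have : 0 < ‖w‖ := norm_pos_iff.2 hw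
  exact lt_of_lt_of_le (by positivity) (hcw w)

theorem b_add_le (h : EigenForms a b) (w v : V) :
    formNorm b (w + v) ≤ formNorm b w + formNorm b v := by
  have hw := h.b_nonneg w
  have hv := h.b_nonneg v
  have h1 : b w v ≤ Real.sqrt (b w w) * Real.sqrt (b v v) := by
    rw [← Real.sqrt_mul hw]
    exact Real.le_sqrt_of_sq_le (h.b_cauchy w v)
  unfold formNorm
  refine Real.sqrt_le_iff.2 ⟨by positivity, ?_⟩
  have h2 := Real.sq_sqrt hw
  have h3 := Real.sq_sqrt hv
  simp only [map_add, LinearMap.add_apply, h.b_symm v w]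
  nlinarith

theorem b_bounded (h : EigenForms a b) : ∃ B : ℝ, ∀ w, formNorm b w ≤ B * ‖w‖ := by
  by_contra hcon
  push Not at hcon
  have key : ∀ n : ℕ, ∃ w : V, ‖w‖ ≤ 1 ∧ (n : ℝ) < formNorm b w := by
    intro n
    obtain ⟨w, hw⟩ := hcon n
    have hw0 : w ≠ 0 := by
      rintro rfl
      simp [formNorm] at hw
    have hp : 0 < ‖w‖ := norm_pos_iff.2 hw0
    refine ⟨‖w‖⁻¹ • w, ?_, ?_⟩
    · rw [norm_smul, norm_inv, norm_norm, inv_mul_cancel₀ hp.ne']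
    · have : formNorm b (‖w‖⁻¹ • w) = ‖w‖⁻¹ * formNorm b w := by
        unfold formNorm
        simp only [map_smul, LinearMap.smul_apply, smul_eq_mul, ← mul_assoc]
        rw [Real.sqrt_mul (by positivity), Real.sqrt_mul_self (by positivity)]
      rw [this, lt_inv_mul_iff₀ hp, mul_comm]
      exact hw
  choose w hw1 hw2 using key
  obtain ⟨φ, hφ, hc⟩ := h.b_compact w ⟨1, hw1⟩
  obtain ⟨N, hN⟩ := hc 1 one_pos
  obtain ⟨m, hm⟩ := exists_nat_gt (1 + formNorm b (w (φ N)))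
  have h1 := hN (max m N) N (le_max_right _ _) le_rfl
  have h2 := h.b_add_le (w (φ (max m N)) - w (φ N)) (w (φ N))
  rw [sub_add_cancel] at h2
  have h3 := hw2 (φ (max m N))
  have h4 : (m : ℝ) ≤ (φ (max m N) : ℝ) := by
    exact_mod_cast (le_max_left m N).trans (hφ.id_le _)
  linarith

theorem b_abs_le (h : EigenForms a b) : ∃ C : ℝ, ∀ w v, ‖b w v‖ ≤ C * ‖w‖ * ‖v‖ := by
  obtain ⟨B, hB⟩ := h.b_bounded
  refine ⟨B ^ 2, fun w v => ?_⟩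
  have h1 : ‖b w v‖ ≤ formNorm b w * formNorm b v := by
    unfold formNorm
    rw [← Real.sqrt_mul (h.b_nonneg w)]
    exact Real.abs_le_sqrt (h.b_cauchy w v)
  have h2 : formNorm b w * formNorm b v ≤ (B * ‖w‖) * (B * ‖v‖) :=
    mul_le_mul (hB w) (hB v) (Real.sqrt_nonneg _) ((Real.sqrt_nonneg _).trans (hB w))
  linarith [h1, h2]

theorem solOp_spec [CompleteSpace V] (h : EigenForms a b) (f v : V) :
    a (solOp a b f) v = b f v := by
  have hex : ∃ T : V →ₗ[ℝ] V, ∀ f v, a (T f) v = b f v := by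
    obtain ⟨Ca, hCa⟩ := h.a_abs_le
    obtain ⟨Cb, hCb⟩ := h.b_abs_le
    let A : V →L[ℝ] V →L[ℝ] ℝ := a.mkContinuous₂ Ca hCa
    let B : V →L[ℝ] V →L[ℝ] ℝ := b.mkContinuous₂ Cb hCb
    have hA : IsCoercive A := by
      obtain ⟨c, hc, hcw⟩ := h.a_coercive
      refine ⟨c, hc, fun w => ?_⟩
      have := hcw w
      rw [sq, ← mul_assoc] at this
      simpa [A] using this
    let E := hA.continuousLinearEquivOfBilin
    let D : V →ₗ[ℝ] V :=
      { toFun := fun f => (InnerProductSpace.toDual ℝ V).symm (B f)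
        map_add' := by intro x y; simp
        map_smul' := by intro r x; simp }
    have hD : ∀ f v, inner ℝ (D f) v = b f v := by
      intro f v
      simp [D, B]
    have hAE : ∀ w v, a w v = inner ℝ (E w) v := by
      intro w v
      rw [hA.continuousLinearEquivOfBilin_apply]
      simp [A]
    refine ⟨(E.symm : V →ₗ[ℝ] V) ∘ₗ D, fun f v => ?_⟩
    rw [hAE, ← hD]
    simp
  unfold solOp
  rw [dif_pos hex]
  exact hex.choose_spec f v

theorem galerkin_spec (h : EigenForms a b) (W : Submodule ℝ V) [FiniteDimensional ℝ W] :
    (∀ w, galerkin a W w ∈ W) ∧ ∀ w, ∀ v ∈ W, a (w - galerkin a W w) v = 0 := by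
  have hex : ∃ P : V →ₗ[ℝ] V, (∀ w, P w ∈ W) ∧ ∀ w, ∀ v ∈ W, a (w - P w) v = 0 := by
    let R : V →ₗ[ℝ] Module.Dual ℝ W := a.compl₂ W.subtype
    let S : W →ₗ[ℝ] Module.Dual ℝ W := R ∘ₗ W.subtype
    have hS : Function.Injective S := by
      rw [← LinearMap.ker_eq_bot, LinearMap.ker_eq_bot']
      intro w hw
      by_contra hne
      have h1 : a (w : V) (w : V) = 0 := by
        have := LinearMap.congr_fun hw w
        simpa [S, R] using this
      exact (h.a_pos (w : V) (by simpa using hne)).ne' h1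
    let e : W ≃ₗ[ℝ] Module.Dual ℝ W :=
      LinearEquiv.ofInjectiveOfFinrankEq S hS Subspace.dual_finrank_eq.symm
    refine ⟨W.subtype ∘ₗ e.symm.toLinearMap ∘ₗ R, fun w => by simp, fun w v hv => ?_⟩
    have h1 : S (e.symm (R w)) = R w := e.apply_symm_apply (R w)
    have h2 := LinearMap.congr_fun h1 ⟨v, hv⟩
    simp only [S, R, LinearMap.comp_apply, LinearMap.compl₂_apply, Submodule.subtype_apply] at h2
    simp only [map_sub, LinearMap.sub_apply, LinearMap.comp_apply, Submodule.subtype_apply,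
      LinearEquiv.coe_coe, R]
    rw [sub_eq_zero]
    exact h2.symm
  unfold galerkin
  rw [dif_pos hex]
  exact hex.choose_spec

end EigenForms

end EigMG

end

/-!
Let `l` be the first eigenvalue, `M` its eigenspace (finite-dimensional by compactness) and `μ > l`
the minimum of the Rayleigh quotient over the complement of `M`, which is the next eigenvalue not
counting multiplicity. On a discrete space `W` with `δ = δ_W(λ₁)`, call the discrete eigenvectors
with eigenvalue `< μ` the low modes.

* For `m ∈ M`, the Galerkin equations and the gap show that the low-mode part of the Galerkin
  projection of `m` is within `O(δ)` of `m` (`IsEigenbasis.approx_eigenvector`). The low modes meet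
  the complement of `M` only in `0`, so a dimension argument gives the converse: every combination
  of low modes is within `O(δ)` of `M` (`IsEigenbasis.exists_close_eigenvector`). Hence the low
  eigenvalues lie in `[l, l + O(δ²)]`, and no discrete eigenvalue lies between these and `μ`.
* Diagonalising `P_h T` and integrating its explicit resolvent identifies the contour integral with
  the `b`-orthogonal projection onto the low modes (`IsEigenbasis.spectralProj_lowModes`): the
  circle encloses the inverses of the low eigenvalues and neither `0` nor anything in `(0, 1/μ]`.
* A shifted inverse iteration step multiplies the ratio of the high-mode part to the low-mode part
  by at most `max |ν - α| / min |ν' - α|`, over low `ν` and high `ν'`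
  (`IsEigenbasis.correction_ratio`). The shift is chosen such that this is at most `1/(2β)` for
  small `h` (`exists_shift_bounds`). Here only `l ≤ λ̄_{2,h₁} ≤ μ + ε` is used, which is true for
  simple and for multiple `l`; the upper bound is where the density of the family enters.
* Measuring all errors by the distance to the fixed space `M`, one level changes a bound `K h_k`
  into `(3/(4β)) (K + O(1)) h_k + O(1) h_{k+1} ≤ K h_{k+1}`, for `K` large and independent of `C₄`,
  `C₅` (`IsMultigridRun.exists_close_eigenvector`). Since `h_n ≤ δ/c₀`, the error estimates
  follow, and those for the eigenvalues hold because Rayleigh quotients are stationary at `M`.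
-/

open Filter Topology TensorProduct

noncomputable section

namespace EigMG

section

/-! ### Norms of symmetric positive semidefinite forms -/

section FormNorm

variable {V : Type*} [AddCommGroup V] [Module ℝ V] {p : V →ₗ[ℝ] V →ₗ[ℝ] ℝ}

theorem formNorm_nonneg (w : V) : 0 ≤ formNorm p w := Real.sqrt_nonneg _

theorem formNorm_sq (hp : ∀ w, 0 ≤ p w w) (w : V) : formNorm p w ^ 2 = p w w :=
  Real.sq_sqrt (hp w)

theorem formNorm_smul (r : ℝ) (w : V) : formNorm p (r • w) = |r| * formNorm p w := by
  unfold formNorm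
  simp only [map_smul, LinearMap.smul_apply, smul_eq_mul, ← mul_assoc]
  rw [Real.sqrt_mul (mul_self_nonneg r), Real.sqrt_mul_self_eq_abs]

theorem formNorm_neg (w : V) : formNorm p (-w) = formNorm p w := by
  simp [formNorm]

theorem formNorm_sub_comm (w v : V) : formNorm p (w - v) = formNorm p (v - w) := by
  rw [← formNorm_neg, neg_sub]

theorem abs_form_le (hs : ∀ w v, p w v = p v w) (hp : ∀ w, 0 ≤ p w w) (w v : V) :
    |p w v| ≤ formNorm p w * formNorm p v := by
  unfold formNorm
  rw [← Real.sqrt_mul (hp w)]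
  exact Real.abs_le_sqrt (LinearMap.BilinForm.apply_sq_le_of_symm p hp ⟨fun x y => hs x y⟩ w v)

theorem formNorm_add_le (hs : ∀ w v, p w v = p v w) (hp : ∀ w, 0 ≤ p w w) (w v : V) :
    formNorm p (w + v) ≤ formNorm p w + formNorm p v := by
  have h1 := (le_abs_self _).trans (abs_form_le hs hp w v)
  refine Real.sqrt_le_iff.2 ⟨add_nonneg (formNorm_nonneg w) (formNorm_nonneg v), ?_⟩
  have h2 := formNorm_sq hp w
  have h3 := formNorm_sq hp v
  simp only [map_add, LinearMap.add_apply, hs v w]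
  nlinarith

theorem formNorm_sub_le (hs : ∀ w v, p w v = p v w) (hp : ∀ w, 0 ≤ p w w) (w v x : V) :
    formNorm p (w - x) ≤ formNorm p (w - v) + formNorm p (v - x) := by
  have := formNorm_add_le hs hp (w - v) (v - x)
  rwa [sub_add_sub_cancel] at this

theorem formNorm_le_add_sub (hs : ∀ w v, p w v = p v w) (hp : ∀ w, 0 ≤ p w w) (w v : V) :
    formNorm p w ≤ formNorm p v + formNorm p (w - v) := by
  have := formNorm_add_le hs hp v (w - v)
  rwa [add_sub_cancel] at this

theorem formNorm_le_of_sq_le {w : V} {r : ℝ} (hr : 0 ≤ r) (h : p w w ≤ r ^ 2) :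
    formNorm p w ≤ r :=
  Real.sqrt_le_iff.2 ⟨hr, h⟩

/-- If the error is orthogonal to the subspace, it realises the distance to it. -/
theorem formNorm_le_of_orthogonal (hs : ∀ w v, p w v = p v w) (hp : ∀ w, 0 ≤ p w w) {w x y : V}
    (h : p (w - x) (x - y) = 0) : formNorm p (w - x) ≤ formNorm p (w - y) := by
  refine Real.sqrt_le_sqrt ?_
  have e : w - y = (w - x) + (x - y) := by abel
  rw [e]
  generalize w - x = e₁ at *
  generalize x - y = e₂ at *
  simp only [map_add, LinearMap.add_apply, hs e₂ e₁, h]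
  linarith [hp e₂]

end FormNorm

namespace EigenForms

variable {V : Type*} [NormedAddCommGroup V] [InnerProductSpace ℝ V] {a b : V →ₗ[ℝ] V →ₗ[ℝ] ℝ}

theorem a_nonneg (h : EigenForms a b) (w : V) : 0 ≤ a w w := by
  by_cases hw : w = 0
  · simp [hw]
  · exact (h.a_pos w hw).le

theorem formNorm_a_pos (h : EigenForms a b) {w : V} (hw : w ≠ 0) : 0 < formNorm a w :=
  Real.sqrt_pos.2 (h.a_pos w hw)

theorem eq_zero_of_a (h : EigenForms a b) {w : V} (hw : a w w = 0) : w = 0 := by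
  by_contra hne
  exact (h.a_pos w hne).ne' hw

theorem eq_zero_of_b (h : EigenForms a b) {w : V} (hw : b w w = 0) : w = 0 := by
  by_contra hne
  exact (h.b_pos w hne).ne' hw

theorem continuous_a (h : EigenForms a b) (v : V) : Continuous fun w => a w v := by
  obtain ⟨C, hC⟩ := h.a_abs_le
  exact ((a.mkContinuous₂ C hC).flip v).continuous

theorem continuous_a_self (h : EigenForms a b) : Continuous fun w => a w w := by
  obtain ⟨C, hC⟩ := h.a_abs_le
  have : Continuous fun w => (a.mkContinuous₂ C hC) w w := by fun_prop
  exact this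

theorem continuous_b_self (h : EigenForms a b) : Continuous fun w => b w w := by
  obtain ⟨C, hC⟩ := h.b_abs_le
  have : Continuous fun w => (b.mkContinuous₂ C hC) w w := by fun_prop
  exact this

/-! ### Minimisers of the Rayleigh quotient -/

/-- A minimising sequence with `b(w,w) = 1` has a `‖·‖_b`-Cauchy subsequence; by the parallelogram
law for `a` this subsequence is Cauchy in `V`, and its limit is a minimiser. Stationarity of the
quotient at the minimiser is the eigenvalue equation on `X`. -/
theorem exists_rayleigh_min [CompleteSpace V] (h : EigenForms a b) (X : Submodule ℝ V)
    (hX : IsClosed (X : Set V)) (hne : X ≠ ⊥) :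
    ∃ s : ℝ, 0 < s ∧ (∀ v ∈ X, s * b v v ≤ a v v) ∧
      ∃ w ∈ X, w ≠ 0 ∧ ∀ v ∈ X, a w v = s * b w v := by
  obtain ⟨x, hxX, hx0⟩ := X.ne_bot_iff.1 hne
  set R : Set ℝ := {r | ∃ w ∈ X, b w w = 1 ∧ a w w = r} with hR
  have hunit : ∀ v ∈ X, v ≠ 0 → a v v / b v v ∈ R := by
    intro v hv hv0
    have hb := h.b_pos v hv0
    have hs : Real.sqrt (b v v) * Real.sqrt (b v v) = b v v := Real.mul_self_sqrt hb.le
    have hs0 : 0 < Real.sqrt (b v v) := Real.sqrt_pos.2 hb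
    refine ⟨(Real.sqrt (b v v))⁻¹ • v, X.smul_mem _ hv, ?_, ?_⟩
    · simp only [map_smul, LinearMap.smul_apply, smul_eq_mul]
      field_simp
      rw [sq, hs]
    · simp only [map_smul, LinearMap.smul_apply, smul_eq_mul]
      rw [← mul_assoc, ← mul_inv, hs]
      field_simp
  have hRne : R.Nonempty := ⟨_, hunit x hxX hx0⟩
  have hRbdd : BddBelow R := ⟨0, by rintro r ⟨w, -, -, rfl⟩; exact h.a_nonneg w⟩
  set s := sInf R with hsdef
  have hs0 : 0 ≤ s := le_csInf hRne (by rintro r ⟨w, -, -, rfl⟩; exact h.a_nonneg w)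
  have hmin : ∀ v ∈ X, s * b v v ≤ a v v := by
    intro v hv
    by_cases hv0 : v = 0
    · simp [hv0]
    · exact (le_div_iff₀ (h.b_pos v hv0)).1 (csInf_le hRbdd (hunit v hv hv0))
  have hseq : ∀ n : ℕ, ∃ w ∈ X, b w w = 1 ∧ a w w < s + 1 / ((n : ℝ) + 1) := by
    intro n
    obtain ⟨r, ⟨w, hw, hb, rfl⟩, hr⟩ := exists_lt_of_csInf_lt hRne
      (show s < s + 1 / ((n : ℝ) + 1) by have : 0 < 1 / ((n : ℝ) + 1) := by positivity
                                         linarith)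
    exact ⟨w, hw, hb, hr⟩
  choose w hwX hwb hwa using hseq
  obtain ⟨c, hc, hcw⟩ := h.a_coercive
  have hbd : ∃ R : ℝ, ∀ n, ‖w n‖ ≤ R := by
    refine ⟨Real.sqrt ((s + 1) / c), fun n => Real.le_sqrt_of_sq_le ?_⟩
    rw [le_div_iff₀ hc]
    have h1 : 1 / ((n : ℝ) + 1) ≤ 1 := by
      rw [div_le_one (by positivity)]
      linarith [n.cast_nonneg (α := ℝ)]
    linarith [hcw (w n), hwa n]
  obtain ⟨φ, hφ, hcau⟩ := h.b_compact w hbd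
  have hcauchy : CauchySeq (fun n => w (φ n)) := by
    rw [Metric.cauchySeq_iff]
    intro ε hε
    -- `η` is chosen with `4η + sη ≤ cε²/2`
    set η := c * ε ^ 2 / (2 * (4 + s)) with hη
    have hη0 : 0 < η := by positivity
    obtain ⟨N₁, hN₁⟩ := hcau (Real.sqrt η) (Real.sqrt_pos.2 hη0)
    obtain ⟨N₂, hN₂⟩ := exists_nat_one_div_lt hη0
    refine ⟨max N₁ N₂, fun m hm n hn => ?_⟩
    have hsmall : ∀ k, max N₁ N₂ ≤ k → a (w (φ k)) (w (φ k)) < s + η := by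
      intro k hk
      have h1 : (N₂ : ℝ) ≤ (φ k : ℝ) := by
        exact_mod_cast ((le_max_right _ _).trans hk).trans (hφ.id_le k)
      have h2 : 1 / ((φ k : ℝ) + 1) ≤ 1 / ((N₂ : ℝ) + 1) := by gcongr
      linarith [hwa (φ k)]
    have h1 := hsmall m hm
    have h2 := hsmall n hn
    have h3 : b (w (φ m) - w (φ n)) (w (φ m) - w (φ n)) < η :=
      (Real.sqrt_lt_sqrt_iff (h.b_nonneg _)).1
        (hN₁ m n ((le_max_left _ _).trans hm) ((le_max_left _ _).trans hn))
    have h4 := hmin _ (X.add_mem (hwX (φ m)) (hwX (φ n)))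
    have h5 := hcw (w (φ m) - w (φ n))
    have hb1 := hwb (φ m)
    have hb2 := hwb (φ n)
    rw [dist_eq_norm]
    generalize w (φ m) = x at *
    generalize w (φ n) = y at *
    simp only [map_add, map_sub, LinearMap.add_apply, LinearMap.sub_apply, h.b_symm y x,
      h.a_symm y x, hb1, hb2] at h3 h4 h5
    have h6 : η * (2 * (4 + s)) = c * ε ^ 2 := by
      rw [hη]; field_simp
    have h7 : c * ‖x - y‖ ^ 2 < c * ε ^ 2 := by nlinarith
    exact lt_of_pow_lt_pow_left₀ 2 hε.le ((mul_lt_mul_iff_right₀ hc).1 h7)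
  obtain ⟨z, hz⟩ := cauchySeq_tendsto_of_complete hcauchy
  have hzX : z ∈ X := hX.mem_of_tendsto hz (Eventually.of_forall fun n => hwX (φ n))
  have hzb : b z z = 1 := by
    refine tendsto_nhds_unique ((h.continuous_b_self.tendsto z).comp hz) ?_
    simp [Function.comp_def, hwb]
  have hza : a z z ≤ s := by
    have h1 : Tendsto (fun n : ℕ => s + 1 / ((n : ℝ) + 1)) atTop (𝓝 (s + 0)) :=
      tendsto_const_nhds.add tendsto_one_div_add_atTop_nhds_zero_nat
    rw [add_zero] at h1
    exact le_of_tendsto_of_tendsto' ((h.continuous_a_self.tendsto z).comp hz)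
      (h1.comp hφ.tendsto_atTop) fun n => (hwa (φ n)).le
  have hz0 : z ≠ 0 := by
    rintro rfl
    simp at hzb
  have hspos : 0 < s := (h.a_pos z hz0).trans_le hza
  refine ⟨s, hspos, hmin, z, hzX, hz0, fun v hv => ?_⟩
  -- `q` is positive semidefinite on `X` with `q(z,z) ≤ 0`, so `q(z,·) = 0` on `X`
  have hq : ∀ t : ℝ, 0 ≤ 2 * t * (a z v - s * b z v) + t ^ 2 * (a v v - s * b v v) := by
    intro t
    have h1 := hmin _ (X.add_mem hzX (X.smul_mem t hv))
    simp only [map_add, map_smul, LinearMap.add_apply, LinearMap.smul_apply, smul_eq_mul,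
      h.b_symm v z, h.a_symm v z, hzb] at h1
    nlinarith
  set d := a z v - s * b z v with hd
  set e := a v v - s * b v v with he
  have he0 : 0 ≤ e := by linarith [hmin v hv]
  by_contra hcon
  have hd0 : d ≠ 0 := fun h0 => hcon (by linarith)
  have h1 := hq (-d / (e + 1))
  have h2 : 2 * (-d / (e + 1)) * d + (-d / (e + 1)) ^ 2 * e = - (d ^ 2 * (e + 2)) / (e + 1) ^ 2 := by
    field_simp
    ring
  rw [h2] at h1
  have h3 : 0 < d ^ 2 * (e + 2) / (e + 1) ^ 2 := by positivity
  rw [neg_div] at h1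
  linarith

end EigenForms

end

section

/-! ### Eigenvalues counted with multiplicity -/

section EigVal

variable {V : Type*} [AddCommGroup V] [Module ℝ V] {a b : V →ₗ[ℝ] V →ₗ[ℝ] ℝ}
  {W : Submodule ℝ V} {j : ℕ} {l t : ℝ}

theorem eigSpace_le_iSup {s : ℝ} (hst : s ≤ t) :
    eigSpace a b W s ≤ ⨆ s : Set.Iic t, eigSpace a b W (s : ℝ) :=
  le_iSup (fun s : Set.Iic t => eigSpace a b W (s : ℝ)) ⟨s, hst⟩

theorem le_of_le_rank_iSup_eigSpace (hj : 1 ≤ j) (hl : ∀ s, eigSpace a b W s ≠ ⊥ → l ≤ s)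
    (ht : (j : Cardinal) ≤
      Module.rank ℝ (⨆ s : Set.Iic t, eigSpace a b W (s : ℝ) : Submodule ℝ V)) : l ≤ t := by
  by_contra hlt
  have hbot : (⨆ s : Set.Iic t, eigSpace a b W (s : ℝ) : Submodule ℝ V) = ⊥ := by
    rw [iSup_eq_bot]
    rintro ⟨s, hs⟩
    by_contra hne
    exact hlt ((hl s hne).trans hs)
  rw [hbot, rank_bot] at ht
  have : j = 0 := by exact_mod_cast le_antisymm ht (zero_le)
  omega

theorem le_eigVal (hj : 1 ≤ j) (hl : ∀ s, eigSpace a b W s ≠ ⊥ → l ≤ s)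
    (ht : (j : Cardinal) ≤
      Module.rank ℝ (⨆ s : Set.Iic t, eigSpace a b W (s : ℝ) : Submodule ℝ V)) :
    l ≤ eigVal a b W j :=
  le_csInf ⟨t, ht⟩ fun _ hr => le_of_le_rank_iSup_eigSpace hj hl hr

theorem eigVal_le (hj : 1 ≤ j) (hl : ∀ s, eigSpace a b W s ≠ ⊥ → l ≤ s)
    (ht : (j : Cardinal) ≤
      Module.rank ℝ (⨆ s : Set.Iic t, eigSpace a b W (s : ℝ) : Submodule ℝ V)) :
    eigVal a b W j ≤ t :=
  csInf_le ⟨l, fun _ hr => le_of_le_rank_iSup_eigSpace hj hl hr⟩ ht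

theorem one_le_rank_iSup_eigSpace (ht : eigSpace a b W t ≠ ⊥) :
    ((1 : ℕ) : Cardinal) ≤
      Module.rank ℝ (⨆ s : Set.Iic t, eigSpace a b W (s : ℝ) : Submodule ℝ V) := by
  rw [Nat.cast_one, Cardinal.one_le_iff_ne_zero, ne_eq, Submodule.rank_eq_zero]
  intro h0
  exact ht (le_bot_iff.1 (h0 ▸ eigSpace_le_iSup le_rfl))

end EigVal

variable {V : Type*} [NormedAddCommGroup V] [InnerProductSpace ℝ V] {a b : V →ₗ[ℝ] V →ₗ[ℝ] ℝ}

/-- `l` is the first eigenvalue of the problem on `V` and `μ > l` the next one not counting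
multiplicity: the minimum of the Rayleigh quotient over the complement of the (finite-dimensional)
eigenspace of `l`. -/
structure SpectralGap (a b : V →ₗ[ℝ] V →ₗ[ℝ] ℝ) (l μ : ℝ) : Prop where
  pos : 0 < l
  lt : l < μ
  eigVal_one : eigVal a b ⊤ 1 = l
  finite_dim : FiniteDimensional ℝ (eigSpace a b ⊤ l)
  rayleigh : ∀ v, l * b v v ≤ a v v
  rayleigh_orth : ∀ v, (∀ m ∈ eigSpace a b ⊤ l, a v m = 0) → μ * b v v ≤ a v v
  first : ∃ φ ∈ eigSpace a b ⊤ l, a φ φ = 1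
  second : ∃ φ ∈ eigSpace a b ⊤ μ, a φ φ = 1

namespace EigenForms

theorem exists_unit (h : EigenForms a b) {X : Submodule ℝ V} {w : V} (hw : w ∈ X) (hw0 : w ≠ 0) :
    ∃ φ ∈ X, a φ φ = 1 := by
  refine ⟨(formNorm a w)⁻¹ • w, X.smul_mem _ hw, ?_⟩
  have h1 := h.formNorm_a_pos hw0
  rw [← formNorm_sq h.a_nonneg, formNorm_smul, abs_of_pos (inv_pos.2 h1), inv_mul_cancel₀ h1.ne',
    one_pow]

theorem eigen_ge_of_rayleigh (h : EigenForms a b) {W : Submodule ℝ V} {l : ℝ}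
    (hl : ∀ v, l * b v v ≤ a v v) (s : ℝ) (hs : eigSpace a b W s ≠ ⊥) : l ≤ s := by
  obtain ⟨x, ⟨hxW, hx⟩, hx0⟩ := (eigSpace a b W s).ne_bot_iff.1 hs
  have h1 := hl x
  rw [hx x hxW] at h1
  exact le_of_mul_le_mul_right h1 (h.b_pos x hx0)

/-- On an eigenspace `‖·‖_a` and `‖·‖_b` are proportional, so that bounded sequences have Cauchy
subsequences. -/
theorem finiteDimensional_eigSpace (h : EigenForms a b) {l : ℝ} (hl : 0 < l) :
    FiniteDimensional ℝ (eigSpace a b ⊤ l) := by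
  by_contra hM
  obtain ⟨R, f, -, hfR, hf⟩ := exists_seq_norm_le_one_le_norm_sub (𝕜 := ℝ) hM
  obtain ⟨φ, hφ, hcau⟩ := h.b_compact (fun n => (f n : V)) ⟨R, fun n => hfR n⟩
  obtain ⟨c, hc, hcw⟩ := h.a_coercive
  obtain ⟨N, hN⟩ := hcau (Real.sqrt (c / l)) (Real.sqrt_pos.2 (by positivity))
  have h1 := (Real.sqrt_lt_sqrt_iff (h.b_nonneg _)).1 (hN N (N + 1) le_rfl (Nat.le_succ N))
  have h2 : 1 ≤ ‖(f (φ N) : V) - f (φ (N + 1))‖ :=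
    hf (hφ.injective.ne (Nat.lt_succ_self N).ne)
  have h3 := hcw ((f (φ N) : V) - f (φ (N + 1)))
  have h4 := (((f (φ N)) - f (φ (N + 1))).2).2 ((f (φ N) : V) - f (φ (N + 1))) Submodule.mem_top
  rw [Submodule.coe_sub] at h4
  rw [h4] at h3
  rw [lt_div_iff₀ hl] at h1
  have h5 : (1 : ℝ) ≤ ‖(f (φ N) : V) - f (φ (N + 1))‖ ^ 2 := one_le_pow₀ h2
  nlinarith

theorem exists_spectralGap [CompleteSpace V] (h : EigenForms a b) (hV : ¬ FiniteDimensional ℝ V) :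
    ∃ l μ, SpectralGap a b l μ := by
  have htop : (⊤ : Submodule ℝ V) ≠ ⊥ := by
    intro h0
    apply hV
    rw [FiniteDimensional, Module.finite_def, Submodule.fg_def]
    exact ⟨∅, Set.finite_empty, by simp [h0]⟩
  obtain ⟨l, hl, hmin, φ, -, hφ0, hφ⟩ := h.exists_rayleigh_min ⊤ (by simp) htop
  have hM := h.finiteDimensional_eigSpace hl
  have hφM : φ ∈ eigSpace a b ⊤ l := ⟨Submodule.mem_top, hφ⟩
  set M := eigSpace a b ⊤ l with hMdef
  obtain ⟨hPmem, hPorth⟩ := h.galerkin_spec M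
  let X : Submodule ℝ V :=
    { carrier := {w | ∀ m ∈ M, a w m = 0}
      zero_mem' := by simp
      add_mem' := by
        intro x y hx hy m hm
        simp [hx m hm, hy m hm]
      smul_mem' := by
        intro r x hx m hm
        simp [hx m hm] }
  have hXcl : IsClosed (X : Set V) := by
    have : (X : Set V) = ⋂ m ∈ M, {w | a w m = 0} := by
      ext w
      simp [X]
    rw [this]
    exact isClosed_biInter fun m _ => isClosed_eq (h.continuous_a m) continuous_const
  have hXne : X ≠ ⊥ := by
    intro h0
    apply hV
    have hMtop : M = ⊤ := by
      rw [eq_top_iff]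
      intro w _
      have h1 : w - galerkin a M w ∈ X := hPorth w
      rw [h0, Submodule.mem_bot, sub_eq_zero] at h1
      rw [h1]
      exact hPmem w
    rw [hMtop] at hM
    exact Module.finite_def.2 (Module.Finite.iff_fg.1 hM)
  obtain ⟨μ, hμ, hμmin, x, hxX, hx0, hx⟩ := h.exists_rayleigh_min X hXcl hXne
  have hxeig : x ∈ eigSpace a b ⊤ μ := by
    refine ⟨Submodule.mem_top, fun v _ => ?_⟩
    have h1 := hx _ (hPorth v)
    have h2 : a x (galerkin a M v) = 0 := hxX _ (hPmem v)
    have h3 : b x (galerkin a M v) = 0 := by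
      have h4 := (hPmem v).2 x Submodule.mem_top
      rw [h.a_symm, h2, h.b_symm] at h4
      exact (mul_eq_zero.1 h4.symm).resolve_left hl.ne'
    simp only [map_sub, h2, h3, sub_zero] at h1
    exact h1
  have hlμ : l < μ := by
    refine lt_of_le_of_ne ?_ ?_
    · exact h.eigen_ge_of_rayleigh (fun v => hmin v Submodule.mem_top) μ
        ((Submodule.ne_bot_iff _).2 ⟨x, hxeig, hx0⟩)
    · rintro rfl
      exact hx0 (h.eq_zero_of_a (hxX x hxeig))
  refine ⟨l, μ, hl, hlμ, ?_, hM, fun v => hmin v Submodule.mem_top, fun v hv => hμmin v hv,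
    h.exists_unit hφM hφ0, h.exists_unit hxeig hx0⟩
  have hge := h.eigen_ge_of_rayleigh (W := ⊤) (fun v => hmin v Submodule.mem_top)
  have hrank := one_le_rank_iSup_eigSpace ((Submodule.ne_bot_iff M).2 ⟨φ, hφM, hφ0⟩)
  exact le_antisymm (eigVal_le le_rfl hge hrank) (le_eigVal le_rfl hge hrank)

end EigenForms

end

section

/-! ### Eigenbases of the discrete problem -/

/-- Two symmetric positive definite forms on a finite-dimensional space are simultaneously
diagonalisable. -/
theorem exists_simultaneous_diagonal {E : Type*} [AddCommGroup E] [Module ℝ E]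
    [FiniteDimensional ℝ E] (a b : E →ₗ[ℝ] E →ₗ[ℝ] ℝ) (ha : ∀ w v, a w v = a v w)
    (hb : ∀ w v, b w v = b v w) (hpos : ∀ w, w ≠ 0 → 0 < b w w) :
    ∃ (N : ℕ) (ψ : Fin N → E) (ν : Fin N → ℝ),
      (∀ i j, b (ψ i) (ψ j) = if i = j then 1 else 0) ∧
      (∀ i v, a (ψ i) v = ν i * b (ψ i) v) ∧ ∀ w, ∑ i, b w (ψ i) • ψ i = w := by
  let core : InnerProductSpace.Core ℝ E :=
    { inner := fun x y => b x y
      conj_inner_symm := fun x y => by simp [hb y x]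
      re_inner_nonneg := fun x => by
        by_cases hx : x = 0
        · simp [hx]
        · simpa using (hpos x hx).le
      add_left := fun x y z => by simp
      smul_left := fun x y r => by simp
      definite := fun x hx => by
        by_contra hne
        exact (hpos x hne).ne' hx }
  let _ : NormedAddCommGroup E := core.toNormedAddCommGroup
  let _ : InnerProductSpace ℝ E := InnerProductSpace.ofCore core.toCore
  have hin : ∀ x y : E, inner ℝ x y = b x y := fun x y => rfl
  let S : E →ₗ[ℝ] E :=
    { toFun := fun x => (InnerProductSpace.toDual ℝ E).symm (LinearMap.toContinuousLinearMap (a x))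
      map_add' := by intro x y; simp
      map_smul' := by intro r x; simp }
  have hS : ∀ x y, b (S x) y = a x y := by
    intro x y
    rw [← hin]
    simp [S]
  have hsym : S.IsSymmetric := by
    intro x y
    rw [hin, hin, hS, hb, hS, ha]
  let e := hsym.eigenvectorBasis rfl
  refine ⟨_, e, hsym.eigenvalues rfl, ?_, ?_, ?_⟩
  · intro i j
    exact orthonormal_iff_ite.1 e.orthonormal i j
  · intro i v
    rw [← hS, hsym.apply_eigenvectorBasis rfl i]
    simp [e]
  · intro w
    conv_rhs => rw [← e.sum_repr w]
    refine Finset.sum_congr rfl fun i _ => ?_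
    rw [e.repr_apply_apply, hin, hb]

section

variable {V : Type*} [AddCommGroup V] [Module ℝ V] {a b : V →ₗ[ℝ] V →ₗ[ℝ] ℝ}

/-- `ψ` is a `b`-orthonormal basis of `W` consisting of eigenvectors of the problem posed on `W`,
with eigenvalues `ν` (in no particular order). -/
structure IsEigenbasis (a b : V →ₗ[ℝ] V →ₗ[ℝ] ℝ) (W : Submodule ℝ V) {N : ℕ}
    (ψ : Fin N → V) (ν : Fin N → ℝ) : Prop where
  mem : ∀ i, ψ i ∈ W
  ortho : ∀ i j, b (ψ i) (ψ j) = if i = j then 1 else 0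
  eig : ∀ i, ∀ v ∈ W, a (ψ i) v = ν i * b (ψ i) v
  expand : ∀ w ∈ W, ∑ i, b w (ψ i) • ψ i = w

/-- The `b`-orthogonal projection onto the span of the `ψ i`, `i ∈ S`, for a `b`-orthonormal
family `ψ`. -/
def specProj (b : V →ₗ[ℝ] V →ₗ[ℝ] ℝ) {N : ℕ} (ψ : Fin N → V) (S : Finset (Fin N)) : V →ₗ[ℝ] V :=
  ∑ i ∈ S, (b.flip (ψ i)).smulRight (ψ i)

theorem specProj_apply {N : ℕ} (ψ : Fin N → V) (S : Finset (Fin N)) (u : V) :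
    specProj b ψ S u = ∑ i ∈ S, b u (ψ i) • ψ i := by
  simp [specProj]

theorem exists_isEigenbasis (W : Submodule ℝ V) [FiniteDimensional ℝ W]
    (ha : ∀ w v, a w v = a v w) (hb : ∀ w v, b w v = b v w) (hpos : ∀ w, w ≠ 0 → 0 < b w w) :
    ∃ (N : ℕ) (ψ : Fin N → V) (ν : Fin N → ℝ), IsEigenbasis a b W ψ ν := by
  obtain ⟨N, ψ, ν, h1, h2, h3⟩ := exists_simultaneous_diagonal
    (a.domRestrict₁₂ W W) (b.domRestrict₁₂ W W)
    (fun w v => ha w v) (fun w v => hb w v) (fun w hw => hpos w (by simpa using hw))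
  refine ⟨N, fun i => (ψ i : V), ν, fun i => (ψ i).2, h1, fun i v hv => h2 i ⟨v, hv⟩,
    fun w hw => ?_⟩
  have h4 := congrArg Subtype.val (h3 ⟨w, hw⟩)
  rw [Submodule.coe_sum] at h4
  exact h4

namespace IsEigenbasis

variable {W : Submodule ℝ V} {N : ℕ} {ψ : Fin N → V} {ν : Fin N → ℝ}

theorem specProj_mem (hψ : IsEigenbasis a b W ψ ν) (S : Finset (Fin N)) (u : V) :
    specProj b ψ S u ∈ W := by
  rw [specProj_apply]
  exact W.sum_mem fun i _ => W.smul_mem _ (hψ.mem i)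

theorem b_specProj_basis (hψ : IsEigenbasis a b W ψ ν) (S : Finset (Fin N)) (u : V) (i : Fin N) :
    b (specProj b ψ S u) (ψ i) = if i ∈ S then b u (ψ i) else 0 := by
  rw [specProj_apply]
  simp [map_sum, LinearMap.sum_apply, hψ.ortho]

theorem b_specProj (S : Finset (Fin N)) (u v : V) :
    b (specProj b ψ S u) v = ∑ i ∈ S, b u (ψ i) * b (ψ i) v := by
  rw [specProj_apply]
  simp [map_sum, LinearMap.sum_apply]

theorem a_specProj (hψ : IsEigenbasis a b W ψ ν) (S : Finset (Fin N)) (u : V) {v : V}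
    (hv : v ∈ W) : a (specProj b ψ S u) v = ∑ i ∈ S, ν i * (b u (ψ i) * b (ψ i) v) := by
  rw [specProj_apply]
  simp only [map_sum, LinearMap.sum_apply, map_smul, LinearMap.smul_apply, smul_eq_mul]
  refine Finset.sum_congr rfl fun i _ => ?_
  rw [hψ.eig i v hv]
  ring

theorem b_specProj_self (hψ : IsEigenbasis a b W ψ ν) (hb : ∀ w v, b w v = b v w)
    (S : Finset (Fin N)) (u : V) :
    b (specProj b ψ S u) (specProj b ψ S u) = ∑ i ∈ S, b u (ψ i) ^ 2 := by
  rw [b_specProj]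
  refine Finset.sum_congr rfl fun i hi => ?_
  rw [hb (ψ i), hψ.b_specProj_basis, if_pos hi, sq]

theorem a_specProj_self (hψ : IsEigenbasis a b W ψ ν) (hb : ∀ w v, b w v = b v w)
    (S : Finset (Fin N)) (u : V) :
    a (specProj b ψ S u) (specProj b ψ S u) = ∑ i ∈ S, ν i * b u (ψ i) ^ 2 := by
  rw [hψ.a_specProj S u (hψ.specProj_mem S u)]
  refine Finset.sum_congr rfl fun i hi => ?_
  rw [hb (ψ i), hψ.b_specProj_basis, if_pos hi, sq]

theorem b_specProj_compl (hψ : IsEigenbasis a b W ψ ν) (hb : ∀ w v, b w v = b v w)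
    (S : Finset (Fin N)) (u v : V) : b (specProj b ψ S u) (specProj b ψ Sᶜ v) = 0 := by
  rw [b_specProj]
  refine Finset.sum_eq_zero fun i hi => ?_
  rw [hb (ψ i), hψ.b_specProj_basis, if_neg (by simpa using hi), mul_zero]

theorem a_specProj_compl (hψ : IsEigenbasis a b W ψ ν) (hb : ∀ w v, b w v = b v w)
    (S : Finset (Fin N)) (u v : V) : a (specProj b ψ S u) (specProj b ψ Sᶜ v) = 0 := by
  rw [hψ.a_specProj S u (hψ.specProj_mem _ v)]
  refine Finset.sum_eq_zero fun i hi => ?_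
  rw [hb (ψ i), hψ.b_specProj_basis, if_neg (by simpa using hi), mul_zero, mul_zero]

theorem specProj_add_compl (hψ : IsEigenbasis a b W ψ ν) (S : Finset (Fin N)) {w : V}
    (hw : w ∈ W) : specProj b ψ S w + specProj b ψ Sᶜ w = w := by
  rw [specProj_apply, specProj_apply, Finset.sum_add_sum_compl, hψ.expand w hw]

theorem sub_specProj (hψ : IsEigenbasis a b W ψ ν) (S : Finset (Fin N)) {w : V}
    (hw : w ∈ W) : w - specProj b ψ S w = specProj b ψ Sᶜ w :=
  sub_eq_of_eq_add' (hψ.specProj_add_compl S hw).symm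

theorem specProj_basis (hψ : IsEigenbasis a b W ψ ν) {S : Finset (Fin N)} {i : Fin N}
    (hi : i ∈ S) : specProj b ψ S (ψ i) = ψ i := by
  rw [specProj_apply]
  simp [hψ.ortho, hi]

theorem a_split (hψ : IsEigenbasis a b W ψ ν) (ha : ∀ w v, a w v = a v w)
    (hb : ∀ w v, b w v = b v w) (S : Finset (Fin N)) {w : V} (hw : w ∈ W) :
    a w w = a (specProj b ψ S w) (specProj b ψ S w) +
      a (specProj b ψ Sᶜ w) (specProj b ψ Sᶜ w) := by
  conv_lhs => rw [← hψ.specProj_add_compl S hw]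
  simp only [map_add, LinearMap.add_apply, hψ.a_specProj_compl hb,
    ha (specProj b ψ Sᶜ w) (specProj b ψ S w)]
  ring

theorem eigenvalue_eq (hψ : IsEigenbasis a b W ψ ν) (i : Fin N) : a (ψ i) (ψ i) = ν i := by
  rw [hψ.eig i _ (hψ.mem i), hψ.ortho, if_pos rfl, mul_one]

theorem mem_eigSpace (hψ : IsEigenbasis a b W ψ ν) (i : Fin N) : ψ i ∈ eigSpace a b W (ν i) :=
  ⟨hψ.mem i, hψ.eig i⟩

theorem ne_zero (hψ : IsEigenbasis a b W ψ ν) (i : Fin N) : ψ i ≠ 0 := by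
  intro h0
  have := hψ.ortho i i
  simp [h0] at this

/-- The projection onto all eigenvectors with eigenvalue `≤ t` maps into the span of the
corresponding eigenspaces. -/
theorem specProj_mem_iSup (hψ : IsEigenbasis a b W ψ ν) {S : Finset (Fin N)} {t : ℝ}
    (hS : ∀ i ∈ S, ν i ≤ t) (u : V) :
    specProj b ψ S u ∈ ⨆ s : Set.Iic t, eigSpace a b W (s : ℝ) := by
  rw [specProj_apply]
  exact Submodule.sum_mem _ fun i hi =>
    Submodule.smul_mem _ _ (eigSpace_le_iSup (hS i hi) (hψ.mem_eigSpace i))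

/-- An eigenvector on `W` is a combination of the `ψ i` with the same eigenvalue. -/
theorem specProj_eq_self_of_mem_eigSpace (hψ : IsEigenbasis a b W ψ ν)
    (ha : ∀ w v, a w v = a v w) (hb : ∀ w v, b w v = b v w) {S : Finset (Fin N)} {θ : ℝ}
    (hS : ∀ i ∉ S, ν i ≠ θ) {u : V} (hu : u ∈ eigSpace a b W θ) : specProj b ψ S u = u := by
  have h0 : specProj b ψ Sᶜ u = 0 := by
    rw [specProj_apply]
    refine Finset.sum_eq_zero fun i hi => ?_
    have h1 := hu.2 _ (hψ.mem i)
    rw [ha, hψ.eig i u hu.1, hb (ψ i)] at h1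
    have h2 : (ν i - θ) * b u (ψ i) = 0 := by linarith
    rw [(mul_eq_zero.1 h2).resolve_left (sub_ne_zero.2 (hS i (by simpa using hi))), zero_smul]
  have := hψ.specProj_add_compl S hu.1
  rwa [h0, add_zero] at this

theorem le_a_specProj (hψ : IsEigenbasis a b W ψ ν) (hb : ∀ w v, b w v = b v w)
    {S : Finset (Fin N)} {t : ℝ} (hS : ∀ i ∈ S, t ≤ ν i) (u : V) :
    t * b (specProj b ψ S u) (specProj b ψ S u) ≤
      a (specProj b ψ S u) (specProj b ψ S u) := by
  rw [hψ.a_specProj_self hb, hψ.b_specProj_self hb, Finset.mul_sum]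
  exact Finset.sum_le_sum fun i hi => mul_le_mul_of_nonneg_right (hS i hi) (sq_nonneg _)

/-- A vector of `W` is at least as close to its spectral projection as to any other vector of the
range. -/
theorem formNorm_compl_le (hψ : IsEigenbasis a b W ψ ν) (ha : ∀ w v, a w v = a v w)
    (hb : ∀ w v, b w v = b v w) (hp : ∀ w, 0 ≤ a w w) (S : Finset (Fin N)) {w : V} (hw : w ∈ W)
    (u : V) : formNorm a (specProj b ψ Sᶜ w) ≤ formNorm a (w - specProj b ψ S u) := by
  rw [← hψ.sub_specProj S hw]
  refine formNorm_le_of_orthogonal ha hp ?_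
  rw [hψ.sub_specProj S hw, ← map_sub, ha, hψ.a_specProj_compl hb]

/-- A step `(a - α b) û = b u` on `W` multiplies the component along `ψ i` by `(ν i - α)⁻¹`. If the
`|ν i - α|` are at most `A` on `S` and at least `B ≥ A / r` off `S`, the ratio of the norms of the
two components shrinks at least by the factor `r`. The statement avoids division since some
`ν i - α`, `i ∈ S`, may vanish. -/
theorem correction_ratio (hψ : IsEigenbasis a b W ψ ν) (ha : ∀ w v, a w v = a v w)
    (hb : ∀ w v, b w v = b v w) (hp : ∀ w, 0 ≤ a w w) {S : Finset (Fin N)} {α A B r : ℝ}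
    (hA0 : 0 ≤ A) (hB0 : 0 < B) (hAB : A ≤ r * B) (hA : ∀ i ∈ S, |ν i - α| ≤ A)
    (hB : ∀ i ∉ S, B ≤ ν i - α) {u uhat : V} (huh : uhat ∈ W)
    (heq : ∀ v ∈ W, a uhat v - α * b uhat v = b u v) :
    formNorm a (specProj b ψ Sᶜ uhat) * formNorm a (specProj b ψ S u) ≤
      r * (formNorm a (specProj b ψ Sᶜ u) * formNorm a (specProj b ψ S uhat)) := by
  have hν : ∀ i, 0 ≤ ν i := fun i => hψ.eigenvalue_eq i ▸ hp _
  have hcoef : ∀ i, b u (ψ i) = (ν i - α) * b uhat (ψ i) := by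
    intro i
    rw [← heq _ (hψ.mem i), ha, hψ.eig i _ huh, hb (ψ i)]
    ring
  have hg : formNorm a (specProj b ψ S u) ≤ A * formNorm a (specProj b ψ S uhat) := by
    refine formNorm_le_of_sq_le (mul_nonneg hA0 (formNorm_nonneg _)) ?_
    rw [mul_pow, formNorm_sq hp, hψ.a_specProj_self hb, hψ.a_specProj_self hb, Finset.mul_sum]
    refine Finset.sum_le_sum fun i hi => ?_
    have h1 : (ν i - α) ^ 2 ≤ A ^ 2 := sq_le_sq' (abs_le.1 (hA i hi)).1 (abs_le.1 (hA i hi)).2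
    rw [hcoef i, mul_pow]
    have := mul_le_mul_of_nonneg_right h1 (mul_nonneg (hν i) (sq_nonneg (b uhat (ψ i))))
    linarith
  have hs : B * formNorm a (specProj b ψ Sᶜ uhat) ≤ formNorm a (specProj b ψ Sᶜ u) := by
    refine Real.le_sqrt_of_sq_le ?_
    rw [mul_pow, formNorm_sq hp, hψ.a_specProj_self hb, hψ.a_specProj_self hb, Finset.mul_sum]
    refine Finset.sum_le_sum fun i hi => ?_
    have h1 : B ^ 2 ≤ (ν i - α) ^ 2 := pow_le_pow_left₀ hB0.le (hB i (by simpa using hi)) 2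
    rw [hcoef i, mul_pow]
    have := mul_le_mul_of_nonneg_right h1 (mul_nonneg (hν i) (sq_nonneg (b uhat (ψ i))))
    linarith
  have hr : 0 ≤ r := by
    by_contra hr
    have := mul_neg_of_neg_of_pos (not_le.1 hr) hB0
    linarith
  calc _ ≤ formNorm a (specProj b ψ Sᶜ uhat) * (r * B * formNorm a (specProj b ψ S uhat)) :=
        mul_le_mul_of_nonneg_left
          (hg.trans (mul_le_mul_of_nonneg_right hAB (formNorm_nonneg _))) (formNorm_nonneg _)
    _ = r * (B * formNorm a (specProj b ψ Sᶜ uhat) * formNorm a (specProj b ψ S uhat)) := by ring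
    _ ≤ _ := mul_le_mul_of_nonneg_left
        (mul_le_mul_of_nonneg_right hs (formNorm_nonneg _)) hr

end IsEigenbasis
end

end

section

/-! ### The contour integral is the spectral projection -/

/-- Resolvent of a combination of orthogonal idempotents which need not sum to `1`. -/
theorem resolvent_sum_smul_idempotents {R ι : Type*} [Ring R] [Algebra ℂ R] [Fintype ι]
    [DecidableEq ι] (e : ι → R) (he : ∀ i j, e i * e j = if i = j then e i else 0) (m : ι → ℂ)
    {z : ℂ} (hz : z ≠ 0) (hzm : ∀ i, z ≠ m i) :
    resolvent (∑ i, m i • e i) z = z⁻¹ • (1 : R) + ∑ i, ((z - m i)⁻¹ - z⁻¹) • e i := by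
  have hmul : ∀ p q : ι → ℂ, (∑ i, p i • e i) * (∑ i, q i • e i) = ∑ i, (p i * q i) • e i := by
    intro p q
    simp [Finset.sum_mul, Finset.mul_sum, he, smul_smul, mul_comm]
  have hval : ∀ i, z * ((z - m i)⁻¹ - z⁻¹) - m i * z⁻¹ - m i * ((z - m i)⁻¹ - z⁻¹) = 0 := by
    intro i
    have : z - m i ≠ 0 := sub_ne_zero.2 (hzm i)
    field_simp
    ring
  have hsum : z • (∑ i, ((z - m i)⁻¹ - z⁻¹) • e i) - z⁻¹ • (∑ i, m i • e i) -
      ∑ i, (m i * ((z - m i)⁻¹ - z⁻¹)) • e i = 0 := by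
    rw [Finset.smul_sum, Finset.smul_sum, ← Finset.sum_sub_distrib, ← Finset.sum_sub_distrib]
    refine Finset.sum_eq_zero fun i _ => ?_
    rw [smul_smul, smul_smul, ← sub_smul, ← sub_smul, mul_comm z⁻¹, hval i, zero_smul]
  have hz1 : z⁻¹ • z • (1 : R) = 1 := by rw [smul_smul, inv_mul_cancel₀ hz, one_smul]
  have hz2 : z • z⁻¹ • (1 : R) = 1 := by rw [smul_smul, mul_inv_cancel₀ hz, one_smul]
  have hr : (z • (1 : R) - ∑ i, m i • e i) *
      (z⁻¹ • (1 : R) + ∑ i, ((z - m i)⁻¹ - z⁻¹) • e i) = 1 := by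
    rw [sub_mul, mul_add, mul_add, hmul]
    simp only [smul_mul_assoc, one_mul, mul_smul_comm, mul_one]
    rw [hz1, ← sub_eq_zero, ← hsum]
    abel
  have hl : (z⁻¹ • (1 : R) + ∑ i, ((z - m i)⁻¹ - z⁻¹) • e i) *
      (z • (1 : R) - ∑ i, m i • e i) = 1 := by
    rw [mul_sub, add_mul, add_mul, hmul]
    simp only [smul_mul_assoc, one_mul, mul_smul_comm, mul_one]
    rw [hz2, ← sub_eq_zero, ← hsum]
    simp only [mul_comm]
    abel
  rw [resolvent, Algebra.algebraMap_eq_smul_one]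
  exact Ring.inverse_unit (⟨_, _, hr, hl⟩ : Rˣ)

theorem circleIntegral_inv_sub_of_notMem {c w : ℂ} {ρ : ℝ} (hρ : 0 ≤ ρ)
    (hw : w ∉ Metric.closedBall c ρ) : (∮ z in C(c, ρ), (z - w)⁻¹) = 0 := by
  have hd : ∀ z ∈ Metric.closedBall c ρ, DifferentiableAt ℂ (fun z => (z - w)⁻¹) z := by
    intro z hz
    have : z - w ≠ 0 := sub_ne_zero.2 (by rintro rfl; exact hw hz)
    fun_prop (disch := exact this)
  exact Complex.circleIntegral_eq_zero_of_differentiable_on_off_countable hρ Set.countable_empty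
    (fun z hz => (hd z hz).continuousAt.continuousWithinAt)
    fun z hz => hd z (Metric.ball_subset_closedBall hz.1)

variable {V : Type*} [NormedAddCommGroup V] [InnerProductSpace ℝ V]
  {a b : V →ₗ[ℝ] V →ₗ[ℝ] ℝ}

namespace IsEigenbasis

variable {W : Submodule ℝ V} {N : ℕ} {ψ : Fin N → V} {ν : Fin N → ℝ}

theorem eigenvalue_pos (hψ : IsEigenbasis a b W ψ ν) (h : EigenForms a b) (i : Fin N) :
    0 < ν i :=
  hψ.eigenvalue_eq i ▸ h.a_pos _ (hψ.ne_zero i)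

theorem galerkin_comp_solOp [CompleteSpace V] [FiniteDimensional ℝ W] (hψ : IsEigenbasis a b W ψ ν)
    (h : EigenForms a b) :
    galerkin a W ∘ₗ solOp a b = ∑ i, (ν i)⁻¹ • specProj b ψ {i} := by
  ext u
  obtain ⟨hP, hPo⟩ := h.galerkin_spec W
  set x := galerkin a W (solOp a b u) with hx
  have hcoef : ∀ i, b x (ψ i) = (ν i)⁻¹ * b u (ψ i) := by
    intro i
    have h1 := hPo (solOp a b u) _ (hψ.mem i)
    rw [map_sub, LinearMap.sub_apply, h.solOp_spec, ← hx, h.a_symm, hψ.eig i x (hP _),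
      h.b_symm (ψ i)] at h1
    rw [sub_eq_zero.1 h1, inv_mul_cancel_left₀ (hψ.eigenvalue_pos h i).ne']
  rw [LinearMap.comp_apply, ← hx, ← hψ.expand x (hP _)]
  simp [specProj_apply, hcoef, LinearMap.sum_apply, smul_smul]

theorem specProj_singleton_mul (hψ : IsEigenbasis a b W ψ ν) (i j : Fin N) :
    (specProj b ψ {i} : Module.End ℝ V) * specProj b ψ {j} =
      if i = j then specProj b ψ {i} else 0 := by
  ext u
  rw [Module.End.mul_apply, specProj_apply, Finset.sum_singleton, hψ.b_specProj_basis]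
  by_cases hij : i = j
  · simp [hij, specProj_apply]
  · simp [hij]

theorem isContourProj_specProj [CompleteSpace V]
    [FiniteDimensional ℝ W] (hψ : IsEigenbasis a b W ψ ν)
    (h : EigenForms a b) {S : Finset (Fin N)} {c : ℂ} {ρ : ℝ} (hρ : 0 < ρ)
    (h0 : (0 : ℂ) ∉ Metric.closedBall c ρ)
    (hin : ∀ i ∈ S, (((ν i)⁻¹ : ℝ) : ℂ) ∈ Metric.ball c ρ)
    (hout : ∀ i ∉ S, (((ν i)⁻¹ : ℝ) : ℂ) ∉ Metric.closedBall c ρ) :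
    IsContourProj a (galerkin a W ∘ₗ solOp a b) c ρ (specProj b ψ S) := by
  intro u v
  set m : Fin N → ℂ := fun i => (((ν i)⁻¹ : ℝ) : ℂ) with hm
  let e : Fin N → Module.End ℂ (ℂ ⊗[ℝ] V) := fun i => (specProj b ψ {i}).baseChange ℂ
  have he : ∀ i j, e i * e j = if i = j then e i else 0 := by
    intro i j
    have h1 := hψ.specProj_singleton_mul i j
    change (specProj b ψ {i}).baseChange ℂ * (specProj b ψ {j}).baseChange ℂ = _
    rw [← LinearMap.baseChange_mul, h1]
    split_ifs <;> simp [e]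
  have hA : ((galerkin a W ∘ₗ solOp a b).baseChange ℂ : Module.End ℂ (ℂ ⊗[ℝ] V)) =
      ∑ i, m i • e i := by
    rw [hψ.galerkin_comp_solOp h]
    ext w
    simp [e, m, LinearMap.sum_apply, TensorProduct.tmul_sum, TensorProduct.smul_tmul']
  have hne : ∀ z ∈ Metric.sphere c ρ, z ≠ 0 ∧ ∀ i, z ≠ m i := by
    intro z hz
    refine ⟨?_, fun i => ?_⟩
    · rintro rfl
      exact h0 (Metric.sphere_subset_closedBall hz)
    · rintro rfl
      by_cases hi : i ∈ S
      · exact (Metric.mem_ball.1 (hin i hi)).ne (Metric.mem_sphere.1 hz)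
      · exact hout i hi (Metric.sphere_subset_closedBall hz)
  have hint : Set.EqOn (fun z => LinearMap.liftBaseChange ℂ
        (Complex.ofRealCLM.toLinearMap ∘ₗ a.flip v)
        ((resolvent ((galerkin a W ∘ₗ solOp a b).baseChange ℂ : Module.End ℂ (ℂ ⊗[ℝ] V)) z)
          ((1 : ℂ) ⊗ₜ[ℝ] u)))
      (fun z => ((a u v : ℝ) : ℂ) * (z - 0)⁻¹ +
        ∑ i, ((a (specProj b ψ {i} u) v : ℝ) : ℂ) * ((z - m i)⁻¹ - (z - 0)⁻¹))
      (Metric.sphere c ρ) := by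
    intro z hz
    dsimp only
    rw [hA, resolvent_sum_smul_idempotents e he m (hne z hz).1 (hne z hz).2]
    simp [e, LinearMap.add_apply, LinearMap.sum_apply, mul_comm]
  have hci : ∀ w ∉ Metric.sphere c ρ, CircleIntegrable (fun z : ℂ => (z - w)⁻¹) c ρ := by
    intro w hw
    refine ContinuousOn.circleIntegrable hρ.le fun z hz => ContinuousAt.continuousWithinAt ?_
    have : z - w ≠ 0 := sub_ne_zero.2 (by rintro rfl; exact hw hz)
    fun_prop (disch := exact this)
  have hcm : ∀ (k : ℂ) (f : ℂ → ℂ), CircleIntegrable f c ρ →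
      CircleIntegrable (fun z => k * f z) c ρ := fun k f hf => IntervalIntegrable.const_mul hf k
  have hci0 := hci 0 fun hz => (hne 0 hz).1 rfl
  have hcim := fun i => hci (m i) fun hz => (hne _ hz).2 i rfl
  have hI0 := circleIntegral_inv_sub_of_notMem hρ.le h0
  have hIi : ∀ i, (∮ z in C(c, ρ), ((z - m i)⁻¹ - (z - 0)⁻¹)) =
      if i ∈ S then 2 * (Real.pi : ℂ) * Complex.I else 0 := by
    intro i
    rw [circleIntegral.integral_sub (hcim i) hci0, hI0, sub_zero]
    split_ifs with hi
    · exact circleIntegral.integral_sub_inv_of_mem_ball (hin i hi)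
    · exact circleIntegral_inv_sub_of_notMem hρ.le (hout i hi)
  rw [circleIntegral.integral_congr hρ.le hint]
  have hterm : ∀ i ∈ (Finset.univ : Finset (Fin N)), CircleIntegrable (fun z =>
      ((a (specProj b ψ {i} u) v : ℝ) : ℂ) * ((z - m i)⁻¹ - (z - 0)⁻¹)) c ρ := fun i _ =>
    hcm _ _ ((hcim i).sub hci0)
  rw [circleIntegral.integral_add (hcm _ _ hci0) (CircleIntegrable.fun_sum _ hterm),
    circleIntegral.integral_fun_sum hterm]
  simp only [circleIntegral.integral_const_mul, hI0, hIi, mul_zero, zero_add]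
  have hpi : (2 * (Real.pi : ℂ) * Complex.I) ≠ 0 := Complex.two_pi_I_ne_zero
  simp only [mul_ite, mul_zero, Finset.sum_ite_mem, Finset.univ_inter, ← Finset.sum_mul]
  rw [mul_comm, mul_assoc, mul_inv_cancel₀ hpi, mul_one, ← Complex.ofReal_sum]
  congr 1
  simp [specProj_apply, map_sum, LinearMap.sum_apply]

theorem spectralProj_eq [CompleteSpace V] [FiniteDimensional ℝ W] (hψ : IsEigenbasis a b W ψ ν)
    (h : EigenForms a b) {S : Finset (Fin N)} {c : ℂ} {ρ : ℝ} (hρ : 0 < ρ)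
    (h0 : (0 : ℂ) ∉ Metric.closedBall c ρ)
    (hin : ∀ i ∈ S, (((ν i)⁻¹ : ℝ) : ℂ) ∈ Metric.ball c ρ)
    (hout : ∀ i ∉ S, (((ν i)⁻¹ : ℝ) : ℂ) ∉ Metric.closedBall c ρ) :
    spectralProj a b W c ρ = specProj b ψ S := by
  have hex := hψ.isContourProj_specProj h hρ h0 hin hout
  have hdef : ∃ Q : V →ₗ[ℝ] V, IsContourProj a (galerkin a W ∘ₗ solOp a b) c ρ Q := ⟨_, hex⟩
  unfold spectralProj
  rw [dif_pos hdef]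
  ext u
  rw [← sub_eq_zero]
  refine h.eq_zero_of_a ?_
  have h1 := (hdef.choose_spec u (hdef.choose u - specProj b ψ S u)).trans
    (hex u (hdef.choose u - specProj b ψ S u)).symm
  rw [map_sub a, LinearMap.sub_apply, Complex.ofReal_injective h1, sub_self]

end IsEigenbasis

end

section

/-! ### Approximation of eigenspaces -/

variable {V : Type*} [NormedAddCommGroup V] [InnerProductSpace ℝ V]
  {a b : V →ₗ[ℝ] V →ₗ[ℝ] ℝ} {l μ : ℝ} {W : Submodule ℝ V}

theorem bestApprox_le (w : V) : bestApprox a W w ≤ formNorm a w := by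
  have h1 : BddBelow (Set.range fun v : W => formNorm a (w - (v : V))) :=
    ⟨0, by rintro _ ⟨v, rfl⟩; exact formNorm_nonneg _⟩
  simpa [bestApprox] using ciInf_le h1 (0 : W)

namespace EigenForms

theorem formNorm_sub_galerkin_le (h : EigenForms a b) [FiniteDimensional ℝ W] (w : V) :
    formNorm a (w - galerkin a W w) ≤ bestApprox a W w := by
  obtain ⟨hP, hPo⟩ := h.galerkin_spec W
  exact le_ciInf fun v => formNorm_le_of_orthogonal h.a_symm h.a_nonneg
    (hPo w _ (W.sub_mem (hP w) v.2))

end EigenForms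

/-- The factor lost when an eigenvector of `l` is approximated in the span of the discrete
eigenvectors with eigenvalue `< μ` instead of the whole discrete space. -/
def gapConst (l μ : ℝ) : ℝ := 1 + (1 - l / μ)⁻¹

namespace SpectralGap

theorem gapConst_pos (g : SpectralGap a b l μ) : 0 < gapConst l μ := by
  have h1 : l / μ < 1 := (div_lt_one (g.pos.trans g.lt)).2 g.lt
  have h2 : 0 < (1 - l / μ)⁻¹ := inv_pos.2 (by linarith)
  unfold gapConst
  linarith

theorem galerkin_error_le (g : SpectralGap a b l μ) (h : EigenForms a b)
    [FiniteDimensional ℝ W] {m : V} (hm : m ∈ eigSpace a b ⊤ l) :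
    formNorm a (m - galerkin a W m) ≤ deltaOne a b W * formNorm a m := by
  by_cases hm0 : m = 0
  · simp [hm0, formNorm]
  have hp := h.formNorm_a_pos hm0
  have hbdd : BddAbove (Set.range fun w : {w : V // w ∈ eigSpace a b ⊤ (eigVal a b ⊤ 1) ∧
      formNorm a w = 1} => bestApprox a W w.1) :=
    ⟨1, by rintro _ ⟨w, rfl⟩; exact (bestApprox_le _).trans_eq w.2.2⟩
  have h1 : bestApprox a W ((formNorm a m)⁻¹ • m) ≤ deltaOne a b W := by
    refine le_ciSup hbdd ⟨(formNorm a m)⁻¹ • m, ?_, ?_⟩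
    · rw [g.eigVal_one]
      exact Submodule.smul_mem _ _ hm
    · rw [formNorm_smul, abs_of_pos (inv_pos.2 hp), inv_mul_cancel₀ hp.ne']
  have h2 := (h.formNorm_sub_galerkin_le _).trans h1
  rw [map_smul, ← smul_sub, formNorm_smul, abs_of_pos (inv_pos.2 hp), inv_mul_le_iff₀ hp] at h2
  linarith

theorem formNorm_b_le (g : SpectralGap a b l μ) (h : EigenForms a b) (x y : V) :
    b x y ≤ l⁻¹ * (formNorm a x * formNorm a y) := by
  have hl := g.pos
  have h1 : ∀ v, formNorm b v ≤ Real.sqrt l⁻¹ * formNorm a v := by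
    intro v
    unfold formNorm
    rw [← Real.sqrt_mul (inv_nonneg.2 hl.le)]
    refine Real.sqrt_le_sqrt ?_
    rw [le_inv_mul_iff₀ hl]
    exact g.rayleigh v
  have h2 := (le_abs_self _).trans (abs_form_le h.b_symm h.b_nonneg x y)
  have h3 := mul_le_mul (h1 x) (h1 y) (formNorm_nonneg _)
    (mul_nonneg (Real.sqrt_nonneg _) (formNorm_nonneg _))
  have h4 : Real.sqrt l⁻¹ * Real.sqrt l⁻¹ = l⁻¹ := Real.mul_self_sqrt (inv_nonneg.2 hl.le)
  calc b x y ≤ _ := h2.trans h3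
    _ = (Real.sqrt l⁻¹ * Real.sqrt l⁻¹) * (formNorm a x * formNorm a y) := by ring
    _ = _ := by rw [h4]

theorem rayleigh_sub_le (g : SpectralGap a b l μ) (h : EigenForms a b) {m : V}
    (hm : m ∈ eigSpace a b ⊤ l) (w : V) : a w w - l * b w w ≤ formNorm a (w - m) ^ 2 := by
  rw [formNorm_sq h.a_nonneg]
  have h1 := hm.2 m Submodule.mem_top
  have h2 := hm.2 w Submodule.mem_top
  have h3 := mul_nonneg g.pos.le (h.b_nonneg (w - m))
  simp only [map_sub, LinearMap.sub_apply, h.a_symm w m, h.b_symm w m] at *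
  linarith

end SpectralGap

section

variable {N : ℕ} {ψ : Fin N → V} {ν : Fin N → ℝ} [FiniteDimensional ℝ W]

/-- With `y` the part of the Galerkin projection `P φ` outside the range of the spectral projection,
the equations for `φ` and `P φ` give `a(y,y) - s b(y,y) = s b(φ - P φ, y)`, and the left side
controls `‖y‖_a²` because the Rayleigh quotient of `y` is at least `t > s`. -/
theorem IsEigenbasis.approx_eigenvector (hψ : IsEigenbasis a b W ψ ν) (h : EigenForms a b)
    (g : SpectralGap a b l μ) {s t : ℝ} (hs : 0 < s) (hst : s < t) {S : Finset (Fin N)}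
    (hS : ∀ i ∉ S, t ≤ ν i) {φ : V} (hφ : φ ∈ eigSpace a b ⊤ s) :
    formNorm a (φ - specProj b ψ S (galerkin a W φ)) ≤
      (1 + s / l * (1 - s / t)⁻¹) * formNorm a (φ - galerkin a W φ) := by
  obtain ⟨hP, hPo⟩ := h.galerkin_spec W
  set p := galerkin a W φ with hp
  set y := specProj b ψ Sᶜ p with hy
  have hyW : y ∈ W := hψ.specProj_mem _ _
  have hsplit : p - specProj b ψ S p = y := hψ.sub_specProj S (hP φ)
  have hpy : p = specProj b ψ S p + y := (hψ.specProj_add_compl S (hP φ)).symm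
  have h1 : a p y = a y y := by
    conv_lhs => rw [hpy]
    rw [map_add, LinearMap.add_apply, hψ.a_specProj_compl h.b_symm, zero_add]
  have h2 : b p y = b y y := by
    conv_lhs => rw [hpy]
    rw [map_add, LinearMap.add_apply, hψ.b_specProj_compl h.b_symm, zero_add]
  have h3 : a (φ - p) y = 0 := hPo φ y hyW
  have h4 := hφ.2 y Submodule.mem_top
  have h5 := g.formNorm_b_le h (φ - p) y
  have h6 : t * b y y ≤ a y y :=
    hψ.le_a_specProj h.b_symm (fun i hi => hS i (by simpa using hi)) p
  have ht : 0 < t := hs.trans hst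
  have hgap : 0 < 1 - s / t := by
    have := (div_lt_one ht).2 hst
    linarith
  have h7 : (1 - s / t) * formNorm a y ^ 2 ≤
      s * (l⁻¹ * (formNorm a (φ - p) * formNorm a y)) := by
    rw [formNorm_sq h.a_nonneg]
    have h8 : s * b y y ≤ s / t * a y y := by
      rw [div_mul_eq_mul_div, le_div_iff₀ ht]
      nlinarith
    have h9 := mul_le_mul_of_nonneg_left h5 hs.le
    simp only [map_sub, LinearMap.sub_apply] at h3 h9
    rw [h2] at h9
    linarith
  have h10 : formNorm a y ≤ s / l * (1 - s / t)⁻¹ * formNorm a (φ - p) := by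
    rcases (formNorm_nonneg (p := a) y).eq_or_lt with h0 | h0
    · rw [← h0]
      have := g.pos
      exact mul_nonneg (by positivity) (formNorm_nonneg _)
    · have h11 : (1 - s / t) * formNorm a y ≤ s * (l⁻¹ * formNorm a (φ - p)) :=
        le_of_mul_le_mul_right (by linarith) h0
      calc formNorm a y = (1 - s / t)⁻¹ * ((1 - s / t) * formNorm a y) := by
            rw [inv_mul_cancel_left₀ hgap.ne']
        _ ≤ (1 - s / t)⁻¹ * (s * (l⁻¹ * formNorm a (φ - p))) :=
            mul_le_mul_of_nonneg_left h11 (inv_nonneg.2 hgap.le)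
        _ = _ := by ring
  have h12 := formNorm_sub_le h.a_symm h.a_nonneg φ p (specProj b ψ S p)
  rw [hsplit] at h12
  linarith

/-- The indices of the discrete eigenvectors belonging to eigenvalues `< μ`. -/
def lowModes (ν : Fin N → ℝ) (μ : ℝ) : Finset (Fin N) := Finset.univ.filter fun i => ν i < μ

theorem mem_lowModes {ν : Fin N → ℝ} {i : Fin N} : i ∈ lowModes ν μ ↔ ν i < μ := by
  simp [lowModes]

theorem IsEigenbasis.approx_first (hψ : IsEigenbasis a b W ψ ν) (h : EigenForms a b)
    (g : SpectralGap a b l μ) {m : V} (hm : m ∈ eigSpace a b ⊤ l) :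
    formNorm a (m - specProj b ψ (lowModes ν μ) (galerkin a W m)) ≤
      gapConst l μ * deltaOne a b W * formNorm a m := by
  have h1 := hψ.approx_eigenvector h g g.pos g.lt
    (fun i hi => not_lt.1 fun hlt => hi (mem_lowModes.2 hlt)) hm
  rw [div_self g.pos.ne', one_mul] at h1
  have h2 := mul_le_mul_of_nonneg_left (g.galerkin_error_le h (W := W) hm) g.gapConst_pos.le
  rw [← mul_assoc] at h2
  exact h1.trans h2

omit [FiniteDimensional ℝ W] in
/-- On the span of the low modes the Rayleigh quotient is `< μ`, on the complement of the
eigenspace of `l` it is `≥ μ`. -/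
theorem IsEigenbasis.eq_zero_of_orthogonal (hψ : IsEigenbasis a b W ψ ν) (h : EigenForms a b)
    (g : SpectralGap a b l μ) {u : V}
    (hu : ∀ m ∈ eigSpace a b ⊤ l, a (specProj b ψ (lowModes ν μ) u) m = 0) :
    specProj b ψ (lowModes ν μ) u = 0 := by
  have h1 := g.rayleigh_orth _ hu
  rw [hψ.a_specProj_self h.b_symm, hψ.b_specProj_self h.b_symm, Finset.mul_sum] at h1
  have h2 : ∀ i ∈ lowModes ν μ, 0 ≤ (μ - ν i) * b u (ψ i) ^ 2 := fun i hi =>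
    mul_nonneg (sub_nonneg.2 (mem_lowModes.1 hi).le) (sq_nonneg _)
  have h3 : ∑ i ∈ lowModes ν μ, (μ - ν i) * b u (ψ i) ^ 2 = 0 := by
    refine le_antisymm ?_ (Finset.sum_nonneg h2)
    simp only [sub_mul, Finset.sum_sub_distrib]
    linarith
  rw [specProj_apply]
  refine Finset.sum_eq_zero fun i hi => ?_
  have h4 := (Finset.sum_eq_zero_iff_of_nonneg h2).1 h3 i hi
  have h5 := (mul_eq_zero.1 h4).resolve_left (sub_pos.2 (mem_lowModes.1 hi)).ne'
  rw [pow_eq_zero_iff two_ne_zero |>.1 h5, zero_smul]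

/-- The span of the low modes is close to the eigenspace `M` of `l`. The map
`M → W → span of low modes → M`, composed of Galerkin, spectral and `a`-orthogonal projection, is
injective, hence surjective as `dim M < ∞`; so every combination of low modes is the approximation
of some element of `M`. -/
theorem IsEigenbasis.exists_close_eigenvector (hψ : IsEigenbasis a b W ψ ν) (h : EigenForms a b)
    (g : SpectralGap a b l μ) (hδ : gapConst l μ * deltaOne a b W ≤ 1 / 2) (u : V) :
    ∃ m ∈ eigSpace a b ⊤ l, formNorm a (specProj b ψ (lowModes ν μ) u - m) ≤
      2 * gapConst l μ * deltaOne a b W * formNorm a (specProj b ψ (lowModes ν μ) u) := by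
  have := g.finite_dim
  set M := eigSpace a b ⊤ l with hM
  set S := lowModes ν μ with hS
  obtain ⟨hQ, hQo⟩ := h.galerkin_spec M
  let Θ : V →ₗ[ℝ] V := specProj b ψ S ∘ₗ galerkin a W
  let Φ : M →ₗ[ℝ] M := (galerkin a M).codRestrict M hQ ∘ₗ Θ ∘ₗ M.subtype
  have hclose : ∀ m ∈ M, formNorm a (m - Θ m) ≤ gapConst l μ * deltaOne a b W * formNorm a m :=
    fun m hm => hψ.approx_first h g hm
  have horth : ∀ x, galerkin a M (specProj b ψ S x) = 0 → specProj b ψ S x = 0 := by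
    intro x hx
    refine hψ.eq_zero_of_orthogonal h g fun m hm => ?_
    have := hQo (specProj b ψ S x) m hm
    rwa [hx, sub_zero] at this
  have hinj : Function.Injective Φ := by
    rw [← LinearMap.ker_eq_bot, LinearMap.ker_eq_bot']
    intro m hm
    have h1 : Θ (m : V) = 0 := horth _ (congrArg Subtype.val hm)
    have h2 := hclose m m.2
    rw [h1, sub_zero] at h2
    by_contra hne
    have h3 := h.formNorm_a_pos (w := (m : V)) (by simpa using hne)
    nlinarith
  obtain ⟨m, hm⟩ := LinearMap.injective_iff_surjective.1 hinj
    ⟨galerkin a M (specProj b ψ S u), hQ _⟩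
  have h1 : galerkin a M (specProj b ψ S (galerkin a W (m : V) - u)) = 0 := by
    have := congrArg Subtype.val hm
    rw [map_sub, map_sub, sub_eq_zero]
    exact this
  have h2 : Θ (m : V) = specProj b ψ S u := by
    have := horth _ h1
    rw [map_sub, sub_eq_zero] at this
    exact this
  refine ⟨m, m.2, ?_⟩
  have h3 := hclose m m.2
  rw [h2] at h3
  have h4 := formNorm_le_add_sub h.a_symm h.a_nonneg (m : V) (specProj b ψ S u)
  rw [formNorm_sub_comm]
  have h5 := formNorm_nonneg (p := a) (m : V)
  have h6 : formNorm a (m : V) ≤ 2 * formNorm a (specProj b ψ S u) := by nlinarith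
  have h7 : 0 ≤ gapConst l μ * deltaOne a b W := by
    by_contra hneg
    rcases h5.eq_or_lt with h0 | h0
    · obtain ⟨φ, hφ, hφ1⟩ := g.first
      have h8 := hclose φ hφ
      have h9 : formNorm a φ = 1 := by rw [formNorm, hφ1, Real.sqrt_one]
      rw [h9] at h8
      linarith [formNorm_nonneg (p := a) (φ - Θ φ)]
    · nlinarith [formNorm_nonneg (p := a) ((m : V) - specProj b ψ S u)]
  nlinarith

/-- Each low mode is within `O(δ)` of the eigenspace of `l`, so its Rayleigh quotient is within
`O(δ²)` of `l`. -/
theorem IsEigenbasis.eigenvalue_le (hψ : IsEigenbasis a b W ψ ν) (h : EigenForms a b)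
    (g : SpectralGap a b l μ) (hδ : gapConst l μ * deltaOne a b W ≤ 1 / 2) {i : Fin N}
    (hi : i ∈ lowModes ν μ) : ν i ≤ l + (2 * gapConst l μ * deltaOne a b W) ^ 2 * μ := by
  obtain ⟨m, hm, hclose⟩ := hψ.exists_close_eigenvector h g hδ (ψ i)
  rw [hψ.specProj_basis hi] at hclose
  have h1 := g.rayleigh_sub_le h hm (ψ i)
  have h2 := pow_le_pow_left₀ (formNorm_nonneg _) hclose 2
  rw [mul_pow, formNorm_sq h.a_nonneg (ψ i), hψ.eigenvalue_eq i] at h2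
  rw [hψ.eigenvalue_eq i, hψ.ortho, if_pos rfl, mul_one] at h1
  have h3 := mul_le_mul_of_nonneg_left (mem_lowModes.1 hi).le
    (sq_nonneg (2 * gapConst l μ * deltaOne a b W))
  linarith

theorem IsEigenbasis.lowModes_nonempty (hψ : IsEigenbasis a b W ψ ν) (h : EigenForms a b)
    (g : SpectralGap a b l μ) (hδ : gapConst l μ * deltaOne a b W ≤ 1 / 2) :
    (lowModes ν μ).Nonempty := by
  by_contra hne
  obtain ⟨φ, hφ, hφ1⟩ := g.first
  have h1 := hψ.approx_first h g hφ
  have h2 : formNorm a φ = 1 := by rw [formNorm, hφ1, Real.sqrt_one]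
  rw [Finset.not_nonempty_iff_eq_empty.1 hne, specProj_apply, Finset.sum_empty, sub_zero, h2] at h1
  linarith

/-! ### The first two discrete eigenvalues -/

omit [FiniteDimensional ℝ W] in
theorem IsEigenbasis.eigVal_one_le (hψ : IsEigenbasis a b W ψ ν) (h : EigenForms a b)
    (g : SpectralGap a b l μ) (i : Fin N) : l ≤ eigVal a b W 1 ∧ eigVal a b W 1 ≤ ν i := by
  have hge := h.eigen_ge_of_rayleigh (W := W) g.rayleigh
  have hrank := one_le_rank_iSup_eigSpace
    ((Submodule.ne_bot_iff _).2 ⟨_, hψ.mem_eigSpace i, hψ.ne_zero i⟩)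
  exact ⟨le_eigVal le_rfl hge hrank, eigVal_le le_rfl hge hrank⟩

theorem linearIndependent_of_close (h : EigenForms a b) {φ₁ φ₂ x₁ x₂ : V} (h₁ : a φ₁ φ₁ = 1)
    (h₂ : a φ₂ φ₂ = 1) (h₁₂ : a φ₁ φ₂ = 0) (hx₁ : formNorm a (φ₁ - x₁) ≤ 1 / 4)
    (hx₂ : formNorm a (φ₂ - x₂) ≤ 1 / 4) : LinearIndependent ℝ ![x₁, x₂] := by
  rw [LinearIndependent.pair_iff]
  intro s t hst
  have e : s • φ₁ + t • φ₂ = s • (φ₁ - x₁) + t • (φ₂ - x₂) := by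
    rw [smul_sub, smul_sub]
    rw [← sub_eq_zero]
    rw [← hst]
    abel
  have h3 : formNorm a (s • φ₁ + t • φ₂) ≤ (|s| + |t|) / 4 := by
    rw [e]
    refine (formNorm_add_le h.a_symm h.a_nonneg _ _).trans ?_
    rw [formNorm_smul, formNorm_smul]
    nlinarith [abs_nonneg s, abs_nonneg t]
  have h4 : formNorm a (s • φ₁ + t • φ₂) ^ 2 = s ^ 2 + t ^ 2 := by
    rw [formNorm_sq h.a_nonneg]
    simp only [map_add, map_smul, LinearMap.add_apply, LinearMap.smul_apply, smul_eq_mul, h₁, h₂,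
      h₁₂, h.a_symm φ₂ φ₁]
    ring
  have h5 := pow_le_pow_left₀ (formNorm_nonneg _) h3 2
  rw [h4] at h5
  have h6 : s ^ 2 + t ^ 2 ≤ 0 := by
    nlinarith [sq_abs s, sq_abs t, sq_nonneg (|s| - |t|)]
  exact ⟨pow_eq_zero_iff two_ne_zero |>.1 (by nlinarith [sq_nonneg s, sq_nonneg t]),
    pow_eq_zero_iff two_ne_zero |>.1 (by nlinarith [sq_nonneg s, sq_nonneg t])⟩

/-- If `W` resolves one eigenvector of `l` and one of `μ` well enough, the discrete eigenvalues
`≤ t` have total multiplicity at least two. -/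
theorem SpectralGap.eigVal_two_bounds (g : SpectralGap a b l μ) (h : EigenForms a b) {t : ℝ}
    (hμt : μ < t) {φ₁ φ₂ : V} (hφ₁ : φ₁ ∈ eigSpace a b ⊤ l) (hφ₂ : φ₂ ∈ eigSpace a b ⊤ μ)
    (h₁ : a φ₁ φ₁ = 1) (h₂ : a φ₂ φ₂ = 1)
    (hc₁ : (1 + l / l * (1 - l / t)⁻¹) * formNorm a (φ₁ - galerkin a W φ₁) ≤ 1 / 4)
    (hc₂ : (1 + μ / l * (1 - μ / t)⁻¹) * formNorm a (φ₂ - galerkin a W φ₂) ≤ 1 / 4) :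
    l ≤ eigVal a b W 2 ∧ eigVal a b W 2 ≤ t := by
  obtain ⟨N, ψ, ν, hψ⟩ := exists_isEigenbasis (a := a) W h.a_symm h.b_symm h.b_pos
  set S : Finset (Fin N) := Finset.univ.filter fun i => ν i ≤ t with hS
  have hS1 : ∀ i ∉ S, t ≤ ν i := fun i hi => (not_le.1 (by simpa [hS] using hi)).le
  have hS2 : ∀ i ∈ S, ν i ≤ t := fun i hi => by simpa [hS] using hi
  have h₁₂ : a φ₁ φ₂ = 0 := by
    have e1 := hφ₁.2 φ₂ Submodule.mem_top
    have e2 := hφ₂.2 φ₁ Submodule.mem_top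
    rw [h.a_symm, h.b_symm] at e2
    have e3 : (μ - l) * b φ₁ φ₂ = 0 := by linarith
    rw [e1, (mul_eq_zero.1 e3).resolve_left (sub_pos.2 g.lt).ne', mul_zero]
  have hx₁ := (hψ.approx_eigenvector h g g.pos (g.lt.trans hμt) hS1 hφ₁).trans hc₁
  have hx₂ := (hψ.approx_eigenvector h g (g.pos.trans g.lt) hμt hS1 hφ₂).trans hc₂
  have hli := linearIndependent_of_close h h₁ h₂ h₁₂ hx₁ hx₂
  set U : Submodule ℝ V := ⨆ s : Set.Iic t, eigSpace a b W (s : ℝ) with hU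
  have hli' : LinearIndependent ℝ (![⟨_, hψ.specProj_mem_iSup hS2 (galerkin a W φ₁)⟩,
      ⟨_, hψ.specProj_mem_iSup hS2 (galerkin a W φ₂)⟩] : Fin 2 → U) := by
    refine LinearIndependent.of_comp U.subtype ?_
    convert hli using 1
    ext i
    fin_cases i <;> rfl
  -- in particular the infimum defining `eigVal a b W 2` is not the junk value `0` of an empty set
  have hrank : ((2 : ℕ) : Cardinal) ≤ Module.rank ℝ U := by
    simpa using hli'.cardinal_lift_le_rank
  have hge := h.eigen_ge_of_rayleigh (W := W) g.rayleigh
  exact ⟨le_eigVal one_le_two hge hrank, eigVal_le one_le_two hge hrank⟩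

end

end

section

/-! ### One correction step -/

/-- For `κ = 2(1 + C₄/C₅)β` the shift is chosen so that the limiting ratio `(l - α) / (μ - α)` is
at most `1/κ < 1/(2β)`. The strict inequality leaves room for the perturbations of the two
eigenvalues. The second eigenvalue `lam2` only needs the bounds `l` and (almost) `μ`, which hold
whether or not `l` is simple. -/
theorem exists_shift_bounds {l μ β C₄ C₅ : ℝ} (hl : 0 < l) (hlμ : l < μ) (hβ : 1 < β)
    (h₄ : 0 < C₄) (h₅ : 0 < C₅) :
    ∃ ε, 0 < ε ∧ ∀ lam lam2, lam ≤ l + ε → l ≤ lam → l ≤ lam2 → lam2 ≤ μ + ε →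
      ∃ A B, 0 ≤ A ∧ 0 < B ∧ A ≤ 1 / (2 * β) * B ∧
        (∀ x, l ≤ x → x ≤ l + ε → |x - shift C₄ C₅ β lam lam2| ≤ A) ∧
        ∀ x, μ ≤ x → B ≤ x - shift C₄ C₅ β lam lam2 := by
  set q := 2 * (1 + C₄ / C₅) * β with hq
  have hq2 : 2 * β < q := by
    have : 0 < C₄ / C₅ := div_pos h₄ h₅
    nlinarith
  have hq1 : 0 < q - 1 := by linarith
  set D := μ - l with hD
  have hD0 : 0 < D := sub_pos.2 hlμ
  set ε := min (D * (q - 2 * β) / ((2 * β) * (q + 1))) (D / (6 * β + 2)) with hε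
  have hε0 : 0 < ε := lt_min (div_pos (mul_pos hD0 (by linarith)) (by nlinarith))
    (div_pos hD0 (by linarith))
  have hε1 : ε * ((2 * β) * (q + 1)) ≤ D * (q - 2 * β) :=
    (le_div_iff₀ (by nlinarith)).1 (min_le_left _ _)
  have hε2 : ε * (6 * β + 2) ≤ D := (le_div_iff₀ (by linarith)).1 (min_le_right _ _)
  refine ⟨ε, hε0, fun lam lam2 h1 h2 h3 h4 => ?_⟩
  set α := shift C₄ C₅ β lam lam2 with hα
  have hup : α ≤ l + 2 * ε := by
    refine max_le (by linarith) ?_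
    rw [div_le_iff₀ hq1]
    have : q * lam ≤ q * (l + ε) := mul_le_mul_of_nonneg_left h1 (by linarith)
    nlinarith
  have hlow : q * l - μ - ε ≤ α * (q - 1) := by
    have h5 : (q * lam - lam2) / (q - 1) ≤ α := le_max_right _ _
    rw [div_le_iff₀ hq1] at h5
    have : q * l ≤ q * lam := mul_le_mul_of_nonneg_left h2 (by linarith)
    linarith
  have hx : (l - α) * (q - 1) ≤ D + ε := by linarith
  refine ⟨|l - α| + ε, D + (l - α), by positivity, ?_, ?_, ?_, ?_⟩
  · nlinarith
  · rw [div_mul_eq_mul_div, one_mul, le_div_iff₀ (by linarith)]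
    rcases abs_cases (l - α) with ⟨h5, h6⟩ | ⟨h5, h6⟩
    · rw [h5]
      have h7 : ((l - α + ε) * (2 * β)) * (q - 1) ≤ (D + (l - α)) * (q - 1) := by
        have h8 : (l - α) * (q - 1) * (2 * β - 1) ≤ (D + ε) * (2 * β - 1) :=
          mul_le_mul_of_nonneg_right hx (by linarith)
        nlinarith
      exact le_of_mul_le_mul_right h7 hq1
    · rw [h5]
      nlinarith
  · intro x hx1 hx2
    have h5 := abs_le.1 (le_refl |l - α|)
    rw [abs_le]
    constructor <;> linarith
  · intro x hx1
    linarith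

variable {V : Type*} [NormedAddCommGroup V] [InnerProductSpace ℝ V]
  {a b : V →ₗ[ℝ] V →ₗ[ℝ] ℝ} {l μ : ℝ} {W : Submodule ℝ V}

namespace SpectralGap

/-- A unit vector close to the eigenspace has a Rayleigh quotient close to `l`, to second order. -/
theorem rayleigh_quotient_bounds (g : SpectralGap a b l μ) (h : EigenForms a b) {u m : V}
    (hu : a u u = 1) (hm : m ∈ eigSpace a b ⊤ l) {d : ℝ} (hd : formNorm a (u - m) ≤ d)
    (hd2 : d ^ 2 ≤ 1 / 2) : l ≤ a u u / b u u ∧ a u u / b u u ≤ l + 2 * l * d ^ 2 := by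
  have hl := g.pos
  have hb : 0 < b u u := h.b_pos u (by rintro rfl; simp at hu)
  have h1 := g.rayleigh_sub_le h hm u
  have h2 := pow_le_pow_left₀ (formNorm_nonneg _) hd 2
  have h3 := g.rayleigh u
  rw [hu] at *
  refine ⟨(le_div_iff₀ hb).2 h3, (div_le_iff₀ hb).2 ?_⟩
  have h4 : 0 ≤ d ^ 2 := sq_nonneg d
  nlinarith

/-- Normalising a vector of the eigenspace at most doubles its distance to a unit vector. -/
theorem exists_unit_eigenvector (h : EigenForms a b) {u m : V}
    (hu : a u u = 1) (hm : m ∈ eigSpace a b ⊤ l) {d : ℝ} (hd : formNorm a (u - m) ≤ d)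
    (hd1 : d < 1) : ∃ m' ∈ eigSpace a b ⊤ l, formNorm a m' = 1 ∧ formNorm a (m' - u) ≤ 2 * d := by
  have hu1 : formNorm a u = 1 := by rw [formNorm, hu, Real.sqrt_one]
  have h1 := formNorm_le_add_sub h.a_symm h.a_nonneg u m
  have h2 := formNorm_le_add_sub h.a_symm h.a_nonneg m u
  rw [formNorm_sub_comm m u] at h2
  have hm0 : 0 < formNorm a m := by linarith
  refine ⟨(formNorm a m)⁻¹ • m, Submodule.smul_mem _ _ hm, ?_, ?_⟩
  · rw [formNorm_smul, abs_of_pos (inv_pos.2 hm0), inv_mul_cancel₀ hm0.ne']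
  · have h3 := formNorm_sub_le h.a_symm h.a_nonneg ((formNorm a m)⁻¹ • m) m u
    have h4 : (formNorm a m)⁻¹ • m - m = ((formNorm a m)⁻¹ - 1) • m := by
      rw [sub_smul, one_smul]
    have h5 : formNorm a ((formNorm a m)⁻¹ • m - m) = |1 - formNorm a m| := by
      rw [h4, formNorm_smul]
      nth_rewrite 2 [← abs_of_pos hm0]
      rw [← abs_mul, sub_mul, inv_mul_cancel₀ hm0.ne', one_mul]
    have h6 : |1 - formNorm a m| ≤ d := abs_le.2 ⟨by linarith, by linarith⟩
    rw [h5, formNorm_sub_comm m u] at h3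
    linarith

end SpectralGap

section

variable {N : ℕ} {ψ : Fin N → V} {ν : Fin N → ℝ} [FiniteDimensional ℝ W]

theorem IsEigenbasis.formNorm_highModes_le (hψ : IsEigenbasis a b W ψ ν) (h : EigenForms a b)
    (g : SpectralGap a b l μ) {u m : V} (huW : u ∈ W) (hm : m ∈ eigSpace a b ⊤ l)
    {d : ℝ} (hd : formNorm a (u - m) ≤ d) :
    formNorm a (specProj b ψ (lowModes ν μ)ᶜ u) ≤
      d + gapConst l μ * deltaOne a b W * formNorm a m := by
  refine (hψ.formNorm_compl_le h.a_symm h.b_symm h.a_nonneg _ huW (galerkin a W m)).trans ?_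
  refine (formNorm_sub_le h.a_symm h.a_nonneg _ m _).trans ?_
  exact add_le_add hd (hψ.approx_first h g hm)

/-- One correction step: the part of the new iterate outside the span of the low modes is reduced
by the factor `r` (up to normalisation), and the low modes are within `O(δ)` of the eigenspace. -/
theorem IsEigenbasis.correction_step (hψ : IsEigenbasis a b W ψ ν) (h : EigenForms a b)
    (g : SpectralGap a b l μ) {α A B r lam' d e : ℝ} (hr : 0 ≤ r)
    (hA0 : 0 ≤ A) (hB0 : 0 < B) (hAB : A ≤ r * B) (hA : ∀ i ∈ lowModes ν μ, |ν i - α| ≤ A)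
    (hB : ∀ i ∉ lowModes ν μ, B ≤ ν i - α) {u u' m : V} (huW : u ∈ W) (hu : a u u = 1)
    (hm : m ∈ eigSpace a b ⊤ l) (hd : formNorm a (u - m) ≤ d)
    (he : 2 * gapConst l μ * deltaOne a b W ≤ e) (he0 : 0 ≤ e) (hde : d + e ≤ 1 / 3)
    (hcor : IsCorrection a b α u W lam' u') :
    u' ∈ W ∧ a u' u' = 1 ∧ lam' = a u' u' / b u' u' ∧
      ∃ m' ∈ eigSpace a b ⊤ l, formNorm a (u' - m') ≤ 3 / 2 * r * (d + e) + e := by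
  obtain ⟨uhat, huh, heq, rfl, hlam⟩ := hcor
  have hu1 : formNorm a u = 1 := by rw [formNorm, hu, Real.sqrt_one]
  -- nestedness, `u ∈ W`, rules out `û = 0`, even if the shift is a discrete eigenvalue
  have huh0 : uhat ≠ 0 := by
    rintro rfl
    have h1 := heq u huW
    simp only [map_zero, LinearMap.zero_apply, mul_zero, sub_zero] at h1
    rw [h.eq_zero_of_b h1.symm] at hu
    simp at hu
  have hn := h.formNorm_a_pos huh0
  set S := lowModes ν μ with hS
  have hsplit : ∀ w ∈ W, formNorm a w ^ 2 =
      formNorm a (specProj b ψ S w) ^ 2 + formNorm a (specProj b ψ Sᶜ w) ^ 2 := by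
    intro w hw
    simp only [formNorm_sq h.a_nonneg]
    exact hψ.a_split h.a_symm h.b_symm S hw
  have hmn : formNorm a m ≤ 2 := by
    have := formNorm_le_add_sub h.a_symm h.a_nonneg m u
    rw [formNorm_sub_comm m u] at this
    linarith
  have hs : formNorm a (specProj b ψ Sᶜ u) ≤ d + e := by
    refine (hψ.formNorm_highModes_le h g huW hm hd).trans ?_
    have h0 := formNorm_nonneg (p := a) m
    nlinarith
  have hlow : 2 / 3 ≤ formNorm a (specProj b ψ S u) := by
    have h1 := hsplit u huW
    rw [hu1] at h1
    have h2 := formNorm_nonneg (p := a) (specProj b ψ S u)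
    have h3 := formNorm_nonneg (p := a) (specProj b ψ Sᶜ u)
    nlinarith
  have hratio := hψ.correction_ratio h.a_symm h.b_symm h.a_nonneg hA0 hB0 hAB hA hB huh heq
  have hhat : formNorm a (specProj b ψ S uhat) ≤ formNorm a uhat := by
    refine le_of_sq_le_sq ?_ hn.le
    have h1 := sq_nonneg (formNorm a (specProj b ψ Sᶜ uhat))
    linarith [hsplit uhat huh]
  have hhigh : formNorm a (specProj b ψ Sᶜ uhat) ≤ 3 / 2 * r * (d + e) * formNorm a uhat := by
    have h1 : formNorm a (specProj b ψ Sᶜ uhat) * (2 / 3) ≤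
        formNorm a (specProj b ψ Sᶜ uhat) * formNorm a (specProj b ψ S u) :=
      mul_le_mul_of_nonneg_left hlow (formNorm_nonneg _)
    have h2 : r * (formNorm a (specProj b ψ Sᶜ u) * formNorm a (specProj b ψ S uhat)) ≤
        r * ((d + e) * formNorm a uhat) :=
      mul_le_mul_of_nonneg_left (mul_le_mul hs hhat (formNorm_nonneg _)
        ((formNorm_nonneg _).trans hs)) hr
    linarith
  set u' := (formNorm a uhat)⁻¹ • uhat with hu'
  have hu'W : u' ∈ W := W.smul_mem _ huh
  have hu'1 : formNorm a u' = 1 := by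
    rw [hu', formNorm_smul, abs_of_pos (inv_pos.2 hn), inv_mul_cancel₀ hn.ne']
  have hhigh' : formNorm a (specProj b ψ Sᶜ u') ≤ 3 / 2 * r * (d + e) := by
    rw [hu', map_smul, formNorm_smul, abs_of_pos (inv_pos.2 hn), inv_mul_le_iff₀ hn]
    linarith
  have hlow' : formNorm a (specProj b ψ S u') ≤ 1 := by
    have h1 := hsplit u' hu'W
    rw [hu'1] at h1
    have h2 := formNorm_nonneg (p := a) (specProj b ψ S u')
    nlinarith [sq_nonneg (formNorm a (specProj b ψ Sᶜ u'))]
  have hd0 := (formNorm_nonneg _).trans hd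
  obtain ⟨m', hm', hclose⟩ := hψ.exists_close_eigenvector h g (by linarith) u'
  refine ⟨hu'W, ?_, hlam, m', hm', ?_⟩
  · rw [← formNorm_sq h.a_nonneg, hu'1, one_pow]
  · have h1 := formNorm_sub_le h.a_symm h.a_nonneg u' (specProj b ψ S u') m'
    rw [hψ.sub_specProj S hu'W] at h1
    have h2 : formNorm a (specProj b ψ S u' - m') ≤ e := by
      refine hclose.trans ?_
      have h3 := formNorm_nonneg (p := a) (specProj b ψ S u')
      nlinarith
    linarith

/-- Discrete eigenvectors with eigenvalue `< μ` are close to the eigenspace. -/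
theorem IsEigenbasis.discrete_eigenvector_close (hψ : IsEigenbasis a b W ψ ν)
    (h : EigenForms a b) (g : SpectralGap a b l μ) (hδ : gapConst l μ * deltaOne a b W ≤ 1 / 2)
    {θ : ℝ} (hθ : θ < μ) {u : V} (hu : u ∈ eigSpace a b W θ) :
    ∃ m ∈ eigSpace a b ⊤ l,
      formNorm a (u - m) ≤ 2 * gapConst l μ * deltaOne a b W * formNorm a u := by
  have h1 := hψ.specProj_eq_self_of_mem_eigSpace h.a_symm h.b_symm (S := lowModes ν μ)
    (fun i hi h0 => hi (mem_lowModes.2 (h0 ▸ hθ))) hu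
  have h2 := hψ.exists_close_eigenvector h g hδ u
  rwa [h1] at h2

theorem IsEigenbasis.spectralProj_lowModes [CompleteSpace V] (hψ : IsEigenbasis a b W ψ ν)
    (h : EigenForms a b) (g : SpectralGap a b l μ) {c : ℂ} {ρ : ℝ}
    (hΓ : EnclosesFirst a b c ρ)
    (hin : ∀ i ∈ lowModes ν μ, (((ν i)⁻¹ : ℝ) : ℂ) ∈ Metric.ball c ρ) :
    spectralProj a b W c ρ = specProj b ψ (lowModes ν μ) := by
  obtain ⟨h1, h2⟩ := hΓ
  rw [g.eigVal_one] at h1 h2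
  have hρ : 0 < ρ := Metric.pos_of_mem_ball h1
  have hμ0 : 0 < μ := g.pos.trans g.lt
  have hμ : ((μ⁻¹ : ℝ) : ℂ) ∉ Metric.closedBall c ρ := by
    refine h2 μ ?_ g.lt.ne'
    obtain ⟨φ, hφ, hφ1⟩ := g.second
    exact (Submodule.ne_bot_iff _).2 ⟨φ, hφ, by rintro rfl; simp at hφ1⟩
  have hμl : μ⁻¹ < l⁻¹ := (inv_lt_inv₀ hμ0 g.pos).2 g.lt
  -- the disc meets the real axis in an interval around `1/l` which does not reach `1/μ`
  have hout : ∀ x : ℝ, x ≤ μ⁻¹ → ((x : ℝ) : ℂ) ∉ Metric.closedBall c ρ := by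
    intro x hx hmem
    have hconv : Convex ℝ (Complex.ofRealCLM ⁻¹' Metric.closedBall c ρ) :=
      (convex_closedBall c ρ).linear_preimage Complex.ofRealCLM.toLinearMap
    exact hμ (hconv.ordConnected.out (x := x) (y := l⁻¹) hmem
      (Metric.ball_subset_closedBall h1) ⟨hx, hμl.le⟩)
  refine hψ.spectralProj_eq h hρ ?_ hin fun i hi => ?_
  · simpa using hout 0 (inv_nonneg.2 hμ0.le)
  · refine hout _ ?_
    have h3 : μ ≤ ν i := not_lt.1 fun hlt => hi (mem_lowModes.2 hlt)
    exact inv_anti₀ hμ0 h3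

end

end

/-! ### The multigrid iteration -/

variable {V : Type*} [NormedAddCommGroup V] [InnerProductSpace ℝ V]
  {a b : V →ₗ[ℝ] V →ₗ[ℝ] ℝ} {l μ : ℝ}

theorem IsApproxFamily.exists_size {ι : Type*} {size : ι → ℝ} {Vh : ι → Submodule ℝ V}
    (hVh : IsApproxFamily a size Vh) {P : ι → Prop}
    (hP : ∀ᶠ i in comap size (𝓝[>] 0), P i) : ∃ h₀ : ℝ, 0 < h₀ ∧ ∀ i, size i < h₀ → P i := by
  rw [eventually_comap] at hP
  obtain ⟨h₀, hh₀, hsub⟩ := mem_nhdsGT_iff_exists_Ioo_subset.1 hP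
  exact ⟨h₀, hh₀, fun i hi => hsub ⟨hVh.size_pos i, hi⟩ i rfl⟩

theorem IsApproxFamily.exists_eigVal_two_bounds {ι : Type*} {size : ι → ℝ}
    {Vh : ι → Submodule ℝ V} (hVh : IsApproxFamily a size Vh) (h : EigenForms a b)
    (g : SpectralGap a b l μ) {ε : ℝ} (hε : 0 < ε) :
    ∃ h₀ : ℝ, 0 < h₀ ∧ ∀ i, size i < h₀ →
      l ≤ eigVal a b (Vh i) 2 ∧ eigVal a b (Vh i) 2 ≤ μ + ε := by
  obtain ⟨φ₁, hφ₁, h₁⟩ := g.first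
  obtain ⟨φ₂, hφ₂, h₂⟩ := g.second
  have key : ∀ (K : ℝ) (φ : V), ∀ᶠ i in comap size (𝓝[>] 0),
      K * bestApprox a (Vh i) φ ≤ 1 / 4 := by
    intro K φ
    have h3 := (hVh.approx φ).const_mul K
    rw [mul_zero] at h3
    exact (h3.eventually (gt_mem_nhds (show (0 : ℝ) < 1 / 4 by norm_num))).mono
      fun i hi => le_of_lt hi
  have hpos : ∀ s, 0 < s → s ≤ μ → 0 ≤ 1 + s / l * (1 - s / (μ + ε))⁻¹ := by
    intro s hs hsμ
    have hl := g.pos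
    have hμ := g.pos.trans g.lt
    have h3 : s / (μ + ε) ≤ 1 := (div_le_one (by linarith)).2 (by linarith)
    have h4 : 0 ≤ (1 - s / (μ + ε))⁻¹ := inv_nonneg.2 (by linarith)
    positivity
  obtain ⟨h₀, hh₀, hsize⟩ := hVh.exists_size
    ((key (1 + l / l * (1 - l / (μ + ε))⁻¹) φ₁).and (key (1 + μ / l * (1 - μ / (μ + ε))⁻¹) φ₂))
  refine ⟨h₀, hh₀, fun i hi => ?_⟩
  have := hVh.finite_dim i
  obtain ⟨h3, h4⟩ := hsize i hi
  exact g.eigVal_two_bounds h (by linarith) hφ₁ hφ₂ h₁ h₂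
    ((mul_le_mul_of_nonneg_left (h.formNorm_sub_galerkin_le φ₁)
      (hpos l g.pos g.lt.le)).trans h3)
    ((mul_le_mul_of_nonneg_left (h.formNorm_sub_galerkin_le φ₂)
      (hpos μ (g.pos.trans g.lt) le_rfl)).trans h4)

/-- Iterates stay within `11 E h_k` of the eigenspace, with `E h` a bound for `2 gapConst δ_h`:
a correction step from level `k` to level `k + 1` gives the distance
`(3/2) (1/(2β)) (11 E h_k + E h_{k+1}) + E h_{k+1} ≤ 10 E h_{k+1}`, because `h_k = β h_{k+1}`. -/
theorem IsMultigridRun.exists_close_eigenvector {ι : Type*} {size : ι → ℝ}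
    {Vh : ι → Submodule ℝ V} (hVh : IsApproxFamily a size Vh) (h : EigenForms a b)
    (g : SpectralGap a b l μ) {β c₀ C₀ C₄ C₅ ε E h₀ : ℝ} (hβ : 1 < β) (hc₀ : 0 < c₀) (hE : 0 < E)
    (hEC : 2 * gapConst l μ * C₀ ≤ E) (hsmall : 36 * (E * h₀) ≤ 1)
    (hε₁ : 2 * l * (11 * (E * h₀)) ^ 2 ≤ ε) (hε₂ : (E * h₀) ^ 2 * μ ≤ ε)
    (hshift : ∀ lam lam2, lam ≤ l + ε → l ≤ lam → l ≤ lam2 → lam2 ≤ μ + ε →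
      ∃ A B, 0 ≤ A ∧ 0 < B ∧ A ≤ 1 / (2 * β) * B ∧
        (∀ x, l ≤ x → x ≤ l + ε → |x - shift C₄ C₅ β lam lam2| ≤ A) ∧
        ∀ x, μ ≤ x → B ≤ x - shift C₄ C₅ β lam lam2)
    {n : ℕ} {τ : ℕ → ι} {lam : ℕ → ℝ} {u : ℕ → V} (hτ : size (τ 1) < h₀)
    (h2 : l ≤ eigVal a b (Vh (τ 1)) 2 ∧ eigVal a b (Vh (τ 1)) 2 ≤ μ + ε)
    (hH : IsHierarchy a b size Vh β c₀ C₀ n τ)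
    (hR : IsMultigridRun a b C₄ C₅ β n (fun k => Vh (τ k)) lam u) :
    ∀ k, 1 ≤ k → k ≤ n → size (τ k) < h₀ ∧ u k ∈ Vh (τ k) ∧ a (u k) (u k) = 1 ∧
      lam k = a (u k) (u k) / b (u k) (u k) ∧
      ∃ m ∈ eigSpace a b ⊤ l, formNorm a (u k - m) ≤ 11 * (E * size (τ k)) := by
  -- consequences of `δ ≤ C₀ h` on a single level
  have hlevel : ∀ k, 1 ≤ k → k ≤ n → size (τ k) < h₀ →
      2 * gapConst l μ * deltaOne a b (Vh (τ k)) ≤ E * size (τ k) ∧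
      gapConst l μ * deltaOne a b (Vh (τ k)) ≤ 1 / 2 ∧ E * size (τ k) ≤ E * h₀ := by
    intro k hk hkn hs
    have h3 := (hH.delta_order k hk hkn).2
    have h4 : 0 < size (τ k) := hVh.size_pos _
    have h5 := mul_le_mul_of_nonneg_left h3 (mul_pos two_pos g.gapConst_pos).le
    have h6 := mul_le_mul_of_nonneg_right hEC h4.le
    have h7 := mul_le_mul_of_nonneg_left hs.le hE.le
    exact ⟨by linarith, by linarith, h7⟩
  intro k hk
  induction k, hk using Nat.le_induction with
  | base =>
    intro hn
    have := hVh.finite_dim (τ 1)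
    obtain ⟨N, ψ, ν, hψ⟩ := exists_isEigenbasis (a := a) (Vh (τ 1)) h.a_symm h.b_symm h.b_pos
    obtain ⟨h3, h4, h5⟩ := hlevel 1 le_rfl hn hτ
    obtain ⟨i, hi⟩ := hψ.lowModes_nonempty h g h4
    have hlt : eigVal a b (Vh (τ 1)) 1 < μ :=
      (hψ.eigVal_one_le h g i).2.trans_lt (mem_lowModes.1 hi)
    have hu := hR.init_vec
    have hu1 := hR.init_norm
    rw [← hR.init_val] at hlt
    obtain ⟨m, hm, hclose⟩ := hψ.discrete_eigenvector_close h g h4 hlt hu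
    refine ⟨hτ, hu.1, hu1, ?_, m, hm, ?_⟩
    · have hb : 0 < b (u 1) (u 1) := h.b_pos _ (by intro h0; simp [h0] at hu1)
      rw [hu.2 _ hu.1]
      field_simp
    · have h6 : 0 < size (τ 1) := hVh.size_pos _
      rw [show formNorm a (u 1) = 1 by rw [formNorm, hu1, Real.sqrt_one], mul_one] at hclose
      nlinarith [mul_pos hE h6]
  | succ k hk ih =>
    intro hkn
    obtain ⟨hs, huW, hu1, hlam, m, hm, hclose⟩ := ih (by omega)
    have href := hH.refine_size k hk (by omega)
    have hsk : 0 < size (τ k) := hVh.size_pos _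
    have hβ0 : 0 < β := one_pos.trans hβ
    have hle : size (τ (k + 1)) ≤ size (τ k) := by
      rw [href]
      exact div_le_self hsk.le hβ.le
    have hβs : β * size (τ (k + 1)) = size (τ k) := by
      rw [href]
      field_simp
    have := hVh.finite_dim (τ (k + 1))
    obtain ⟨N, ψ, ν, hψ⟩ :=
      exists_isEigenbasis (a := a) (Vh (τ (k + 1))) h.a_symm h.b_symm h.b_pos
    have hs' : size (τ (k + 1)) < h₀ := hle.trans_lt hs
    obtain ⟨h3, h4, h5⟩ := hlevel (k + 1) (by omega) hkn hs'
    have h6 := (hlevel k hk (by omega) hs).2.2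
    have h7 : 0 < E * size (τ (k + 1)) := mul_pos hE (hVh.size_pos _)
    have h8 : 0 < E * size (τ k) := mul_pos hE hsk
    have h9 : E * size (τ (k + 1)) ≤ E * size (τ k) := mul_le_mul_of_nonneg_left hle hE.le
    -- `lam k` and the low eigenvalues on the next level lie in `[l, l + ε]`
    obtain ⟨hl1, hl2⟩ := g.rayleigh_quotient_bounds h hu1 hm hclose (by nlinarith)
    rw [← hlam] at hl1 hl2
    have hlε : lam k ≤ l + ε := by
      have h10 : (11 * (E * size (τ k))) ^ 2 ≤ (11 * (E * h₀)) ^ 2 :=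
        pow_le_pow_left₀ (by positivity) (by linarith) 2
      have h11 := mul_le_mul_of_nonneg_left h10 (mul_pos two_pos g.pos).le
      linarith
    have hνε : ∀ i ∈ lowModes ν μ, ν i ≤ l + ε := by
      intro i hi
      have h10 := hψ.eigenvalue_le h g h4 hi
      have h11 : 0 ≤ 2 * gapConst l μ * deltaOne a b (Vh (τ (k + 1))) := by
        have h12 := (hH.delta_order (k + 1) (by omega) hkn).1
        have h13 := (mul_pos hc₀ (hVh.size_pos (τ (k + 1)))).le.trans h12
        have h14 := g.gapConst_pos
        positivity
      have h12 : (2 * gapConst l μ * deltaOne a b (Vh (τ (k + 1)))) ^ 2 ≤ (E * h₀) ^ 2 :=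
        pow_le_pow_left₀ h11 (h3.trans h5) 2
      have h13 := mul_le_mul_of_nonneg_right h12 (g.pos.trans g.lt).le
      linarith
    obtain ⟨A, B, hA0, hB0, hAB, hA, hB⟩ := hshift _ _ hlε hl1 h2.1 h2.2
    have hlν : ∀ i, l ≤ ν i := fun i =>
      h.eigen_ge_of_rayleigh g.rayleigh _
        ((Submodule.ne_bot_iff _).2 ⟨_, hψ.mem_eigSpace i, hψ.ne_zero i⟩)
    obtain ⟨hW, hn1, hlam', m', hm', hclose'⟩ := hψ.correction_step h g
      (by positivity : 0 ≤ 1 / (2 * β)) hA0 hB0 hAB (fun i hi => hA _ (hlν i) (hνε i hi))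
      (fun i hi => hB _ (not_lt.1 fun hlt => hi (mem_lowModes.2 hlt)))
      (hH.nested k hk (by omega) huW) hu1 hm hclose h3 h7.le (by linarith)
      (hR.step k hk (by omega))
    refine ⟨hs', hW, hn1, hlam', m', hm', hclose'.trans ?_⟩
    have h23 : 3 / 2 * (1 / (2 * β)) * (11 * (E * size (τ k)) + E * size (τ (k + 1))) ≤
        3 / 2 * (1 / (2 * β)) * (12 * (E * size (τ k))) :=
      mul_le_mul_of_nonneg_left (by linarith) (by positivity)
    have h24 : 3 / 2 * (1 / (2 * β)) * (12 * (E * size (τ k))) = 9 * (E * size (τ (k + 1))) := by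
      rw [← hβs]
      field_simp
      ring
    linarith

end EigMG

theorem theorem4p1 {V : Type*} [NormedAddCommGroup V] [InnerProductSpace ℝ V] [CompleteSpace V]
    (hV : ¬ FiniteDimensional ℝ V)
    (a b : V →ₗ[ℝ] V →ₗ[ℝ] ℝ) (hab : EigMG.EigenForms a b)
    {ι : Type*} (size : ι → ℝ) (Vh : ι → Submodule ℝ V) (hVh : EigMG.IsApproxFamily a size Vh)
    (β : ℝ) (hβ : 1 < β) (c₀ C₀ : ℝ) (hc₀ : 0 < c₀) (hC₀ : 0 < C₀)
    (c : ℂ) (ρ : ℝ) (hΓ : EigMG.EnclosesFirst a b c ρ) :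
    ∃ C : ℝ, 0 < C ∧ ∀ C₄ C₅ : ℝ, 0 < C₄ → 0 < C₅ → ∃ h₀ : ℝ, 0 < h₀ ∧
      ∀ (n : ℕ) (τ : ℕ → ι) (lam : ℕ → ℝ) (u : ℕ → V), 1 ≤ n → size (τ 1) < h₀ →
        EigMG.IsHierarchy a b size Vh β c₀ C₀ n τ →
        EigMG.IsMultigridRun a b C₄ C₅ β n (fun k => Vh (τ k)) lam u →
        EigMG.formNorm a (u n - EigMG.spectralProj a b (Vh (τ n)) c ρ (u n))
            ≤ C * EigMG.deltaOne a b (Vh (τ n)) ∧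
        |lam n - EigMG.eigVal a b (Vh (τ n)) 1| ≤ C * EigMG.deltaOne a b (Vh (τ n)) ^ 2 ∧
        (∃ u₁ ∈ EigMG.eigSpace a b ⊤ (EigMG.eigVal a b ⊤ 1), EigMG.formNorm a u₁ = 1 ∧
          EigMG.formNorm a (u₁ - u n) ≤ C * EigMG.deltaOne a b (Vh (τ n))) ∧
        |EigMG.eigVal a b ⊤ 1 - lam n| ≤ C * EigMG.deltaOne a b (Vh (τ n)) ^ 2 := by
  obtain ⟨l, μ, g⟩ := hab.exists_spectralGap hV
  have hl := g.pos
  have hμ : 0 < μ := g.pos.trans g.lt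
  have hκ := g.gapConst_pos
  set κ := EigMG.gapConst l μ with hκdef
  set E := 2 * κ * C₀ with hEdef
  have hE : 0 < E := by positivity
  -- `D δ` bounds the distance of the iterates to the eigenspace
  set D := 11 * (E / c₀) with hDdef
  have hD : 0 < D := by positivity
  refine ⟨2 * D + 2 * κ + 2 * l * D ^ 2 + 4 * κ ^ 2 * μ, by positivity, fun C₄ C₅ h₄ h₅ => ?_⟩
  obtain ⟨ε, hε, hshift⟩ := EigMG.exists_shift_bounds hl g.lt hβ h₄ h₅
  obtain ⟨h₁, hh₁, htwo⟩ := hVh.exists_eigVal_two_bounds hab g hε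
  -- eigenvalues within `η` of `l` have their inverses inside the circle
  obtain ⟨η, hη, hball⟩ : ∃ η, 0 < η ∧ ∀ x, |x - l| ≤ η → ((x⁻¹ : ℝ) : ℂ) ∈ Metric.ball c ρ := by
    have h1 := hΓ.1
    rw [g.eigVal_one] at h1
    have hcont : ContinuousAt (fun x : ℝ => ((x⁻¹ : ℝ) : ℂ)) l :=
      Complex.continuous_ofReal.continuousAt.comp (continuousAt_inv₀ hl.ne')
    obtain ⟨η, hη, hsub⟩ := Metric.mem_nhds_iff.1
      (hcont.preimage_mem_nhds (Metric.isOpen_ball.mem_nhds h1))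
    refine ⟨η / 2, half_pos hη, fun x hx => hsub ?_⟩
    rw [Metric.mem_ball, Real.dist_eq]
    linarith
  obtain ⟨h₂, hh₂, hsmall, hε₁, hε₂, hη₂⟩ : ∃ h₂ : ℝ, 0 < h₂ ∧ 36 * (E * h₂) ≤ 1 ∧
      2 * l * (11 * (E * h₂)) ^ 2 ≤ ε ∧ (E * h₂) ^ 2 * μ ≤ ε ∧ (E * h₂) ^ 2 * μ ≤ η := by
    have ev : ∀ (f : ℝ → ℝ) (r : ℝ), Continuous f → f 0 = 0 → 0 < r →
        ∀ᶠ x in 𝓝[>] (0 : ℝ), f x ≤ r := by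
      intro f r hf hf0 hr
      have h1 : Tendsto f (𝓝[>] 0) (𝓝 0) := by
        have := hf.tendsto 0
        rw [hf0] at this
        exact this.mono_left nhdsWithin_le_nhds
      exact (h1.eventually (gt_mem_nhds hr)).mono fun x hx => le_of_lt hx
    obtain ⟨x, h1, h2, h3, h4, h5⟩ := ((eventually_mem_nhdsWithin (a := (0 : ℝ)) (s := Set.Ioi 0)).and
      ((ev (fun x => 36 * (E * x)) 1 (by fun_prop) (by simp) one_pos).and
      ((ev (fun x => 2 * l * (11 * (E * x)) ^ 2) ε (by fun_prop) (by simp) hε).and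
      ((ev (fun x => (E * x) ^ 2 * μ) ε (by fun_prop) (by simp) hε).and
      (ev (fun x => (E * x) ^ 2 * μ) η (by fun_prop) (by simp) hη))))).exists
    exact ⟨x, h1, h2, h3, h4, h5⟩
  refine ⟨min h₁ h₂, lt_min hh₁ hh₂, fun n τ lam u hn hτ hH hR => ?_⟩
  obtain ⟨hs, huW, hu1, hlam, m, hm, hclose⟩ := hR.exists_close_eigenvector hVh hab g hβ hc₀ hE
    le_rfl hsmall hε₁ hε₂ hshift (hτ.trans_le (min_le_right _ _))
    (htwo _ (hτ.trans_le (min_le_left _ _))) hH n hn le_rfl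
  set W := Vh (τ n) with hW
  set δ := EigMG.deltaOne a b W with hδdef
  have hsn : 0 < size (τ n) := hVh.size_pos _
  obtain ⟨hδ₁, hδ₂⟩ := hH.delta_order n hn le_rfl
  have hδ : 0 < δ := (mul_pos hc₀ hsn).trans_le hδ₁
  have hEs : E * size (τ n) ≤ E * h₂ := mul_le_mul_of_nonneg_left hs.le hE.le
  have hEs0 : 0 < E * size (τ n) := mul_pos hE hsn
  have hκE : 2 * κ * δ ≤ E * size (τ n) := by
    have := mul_le_mul_of_nonneg_left hδ₂ (mul_pos two_pos hκ).le
    rw [hEdef]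
    linarith
  have hDδ : 11 * (E * size (τ n)) ≤ D * δ := by
    have h1 : size (τ n) ≤ δ / c₀ := (le_div_iff₀ hc₀).2 (by linarith)
    have h2 := mul_le_mul_of_nonneg_left h1 hE.le
    calc 11 * (E * size (τ n)) ≤ 11 * (E * (δ / c₀)) := by linarith
      _ = D * δ := by rw [hDdef]; ring
  have := hVh.finite_dim (τ n)
  obtain ⟨N, ψ, ν, hψ⟩ :=
    EigMG.exists_isEigenbasis (a := a) W hab.a_symm hab.b_symm hab.b_pos
  have hκδ : κ * δ ≤ 1 / 2 := by linarith
  have hν : ∀ i ∈ EigMG.lowModes ν μ, ν i ≤ l + 4 * κ ^ 2 * μ * δ ^ 2 := by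
    intro i hi
    have h1 := hψ.eigenvalue_le hab g hκδ hi
    rw [← hκdef, ← hδdef] at h1
    linarith
  have hin : ∀ i ∈ EigMG.lowModes ν μ, (((ν i)⁻¹ : ℝ) : ℂ) ∈ Metric.ball c ρ := by
    intro i hi
    have h1 := hψ.eigenvalue_le hab g hκδ hi
    rw [← hκdef, ← hδdef] at h1
    have h2 : (2 * κ * δ) ^ 2 ≤ (E * h₂) ^ 2 :=
      pow_le_pow_left₀ (by positivity) (hκE.trans hEs) 2
    have h3 := mul_le_mul_of_nonneg_right h2 hμ.le
    obtain ⟨h4, h5⟩ := hψ.eigVal_one_le hab g i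
    exact hball _ (abs_le.2 ⟨by linarith, by linarith⟩)
  obtain ⟨i, hi⟩ := hψ.lowModes_nonempty hab g hκδ
  obtain ⟨hbar₁, hbar₂⟩ := hψ.eigVal_one_le hab g i
  have hbar₃ := hν i hi
  obtain ⟨hlam₁, hlam₂⟩ := g.rayleigh_quotient_bounds hab hu1 hm hclose (by nlinarith)
  rw [← hlam] at hlam₁ hlam₂
  have hlD : 0 ≤ 2 * l * D ^ 2 * δ ^ 2 := by positivity
  have hκμ : 0 ≤ 4 * κ ^ 2 * μ * δ ^ 2 := by positivity
  have hDκ : 0 ≤ (2 * D + 2 * κ) * δ ^ 2 := by positivity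
  have hDδ0 : 0 ≤ D * δ := by positivity
  have hκδ0 : 0 ≤ κ * δ := by positivity
  have hrest : 0 ≤ (2 * l * D ^ 2 + 4 * κ ^ 2 * μ) * δ := by positivity
  have hlam₃ : lam n ≤ l + 2 * l * D ^ 2 * δ ^ 2 := by
    have h1 : (11 * (E * size (τ n))) ^ 2 ≤ (D * δ) ^ 2 := pow_le_pow_left₀ (by positivity) hDδ 2
    have h2 := mul_le_mul_of_nonneg_left h1 (mul_pos two_pos hl).le
    linarith
  rw [g.eigVal_one]
  refine ⟨?_, ?_, ?_, ?_⟩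
  · rw [hψ.spectralProj_lowModes hab g hΓ hin, hψ.sub_specProj _ huW]
    have h1 := hψ.formNorm_highModes_le hab g huW hm (hclose.trans hDδ)
    have h2 := EigMG.formNorm_le_add_sub hab.a_symm hab.a_nonneg m (u n)
    rw [EigMG.formNorm_sub_comm m, show EigMG.formNorm a (u n) = 1 by
      rw [EigMG.formNorm, hu1, Real.sqrt_one]] at h2
    have h3 : EigMG.formNorm a m ≤ 2 := by linarith
    have h4 := mul_le_mul_of_nonneg_left h3 hκδ0
    rw [← hκdef, ← hδdef] at h1
    linarith
  · rw [abs_le]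
    constructor <;> linarith
  · obtain ⟨m', hm', h1, h2⟩ :=
      EigMG.SpectralGap.exists_unit_eigenvector hab hu1 hm hclose (by linarith)
    exact ⟨m', hm', h1, by linarith⟩
  · rw [abs_le]
    constructor <;> linarith
end
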